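/- A function $f$ on $\mathbb{R}_+=\,]0,\infty[$ is completely monotonic (CM) if it is infinitely differentiable and $(-1)^n f^{(n)}(x)\ge 0$ for all $x>0$, $n\ge 0$. It is LICM if it is CM and locally integrable on $[0,\infty[$. A Bernstein function is a continuous function $g\ge 0$ on $[0,\infty[$ that is differentiable on $]0,\infty[$ with $g'$ CM. With $\tilde g(p)=\int_0^\infty g(t)\,e^{-pt}\,\mathrm{d}t$, a complete Bernstein function (CBF) is a function $f:\mathbb{R}_+\to\mathbb{R}$ of the form $f(x)=x^2\,\tilde g(x)$ with $g$ a Bernstein function. Let $\mathfrak{Q}$ be the set of CBFs, $p^{1/2}\mathfrak{Q}=\{p\mapsto p^{1/2}g(p)\mid g\in\mathfrak{Q}\}$ and $\mathcal{K}=\mathfrak{Q}\cap p^{1/2}\,\mathfrak{Q}$; thus $\kappa\in\mathcal{K}$ if and only if $\kappa(p)$ and $\kappa(p)/p^{1/2}$ are both CBFs. Let $\rho>0$ be a constant. To a function $Q:\mathbb{R}_+\to\,]0,\infty[$ associate the function $\kappa(p)=\rho^{1/2}\,p/Q(p)^{1/2}$, $p>0$. **Theorem.** 1. For every $Q:\mathbb{R}_+\to\,]0,\infty[$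 one has $Q\in\mathfrak{Q}$ if and only if $\kappa\in\mathfrak{Q}\cap p^{1/2}\,\mathfrak{Q}$. In particular this holds for $Q(p)=p\,\tilde G(p)$, where $G$ is any real function on $\mathbb{R}_+$ whose Laplace transform $\tilde G(p)$ converges absolutely and is positive for every $p>0$. 2. The map $Q\mapsto\kappa$ is a bijection of $\mathfrak{Q}\setminus\{0\}$ onto $\mathcal{K}\setminus\{0\}$. 3. If $G$ is LICM and not identically zero on $\mathbb{R}_+$, then $\tilde G(p)$ converges absolutely and $Q(p)=p\,\tilde G(p)>0$ for every $p>0$, and the function $\kappa(p)^2/p$ is a CBF. -/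

import Mathlib

open Set MeasureTheory

noncomputable section

namespace Viscoelastic

/-- The open positive real semi-axis `ℝ₊ = ]0, ∞[`. Functions on `ℝ₊` are functions on this type. -/
abbrev PosReal : Type := Ioi (0 : ℝ)

/-- Completely monotonic functions: all derivatives exist on `]0, ∞[` and
`(-1) ^ n * (D ^ n f) (x) ≥ 0` for all `n ≥ 0` and `x > 0`.
Only the values of `f` on `]0, ∞[` matter. -/
structure IsCM (f : ℝ → ℝ) : Prop where
  contDiffOn : ContDiffOn ℝ ((⊤ : ℕ∞) : WithTop ℕ∞) f (Ioi 0)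
  nonneg : ∀ (n : ℕ) (x : ℝ), 0 < x → 0 ≤ (-1 : ℝ) ^ n * iteratedDerivWithin n f (Ioi 0) x

/-- Locally integrable completely monotonic functions (integrability near `0` is the point). -/
structure IsLICM (f : ℝ → ℝ) : Prop extends IsCM f where
  locallyIntegrableOn : LocallyIntegrableOn f (Ici 0) volume

/-- Bernstein functions: nonnegative continuous functions on `[0, ∞[` which are differentiable on
`]0, ∞[` with a completely monotonic derivative. -/
structure IsBernstein (g : ℝ → ℝ) : Prop where
  nonneg : ∀ x : ℝ, 0 ≤ x → 0 ≤ g x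
  continuousOn : ContinuousOn g (Ici 0)
  differentiableOn : DifferentiableOn ℝ g (Ioi 0)
  deriv_isCM : IsCM (deriv g)

/-- The integrand of the Laplace transform of `f` at `p` is Lebesgue integrable on `]0, ∞[`. -/
def LaplaceConverges (f : ℝ → ℝ) (p : ℝ) : Prop :=
  IntegrableOn (fun t => f t * Real.exp (-(p * t))) (Ioi 0) volume

/-- The Laplace transform `f̃(p) = ∫₀^∞ f(t) exp(-p t) dt`. -/
def laplace (f : ℝ → ℝ) (p : ℝ) : ℝ :=
  ∫ t in Ioi (0 : ℝ), f t * Real.exp (-(p * t))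

/-- The set of complete Bernstein functions: the functions `f : ℝ₊ → ℝ` of the form
`f(x) = x² g̃(x)` with a Bernstein function `g`. (The Laplace transform of a Bernstein function
converges on `ℝ₊`, since a Bernstein function grows at most linearly.) -/
def CBF : Set (PosReal → ℝ) :=
  {f | ∃ g : ℝ → ℝ, IsBernstein g ∧ ∀ x : PosReal, f x = (x : ℝ) ^ 2 * laplace g x}

/-- For a function `f` and a set `S` of functions, the set `f S = {f g | g ∈ S}` of pointwise
products. -/
def mulSet (f : PosReal → ℝ) (S : Set (PosReal → ℝ)) : Set (PosReal → ℝ) :=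
  {h | ∃ g ∈ S, ∀ x, h x = f x * g x}

/-- The set `𝒦`, the intersection of `CBF` and `p ^ (1/2) CBF`. -/
def waveNumberClass : Set (PosReal → ℝ) :=
  CBF ∩ mulSet (fun p => Real.sqrt p) CBF

/-- The function `Q(p) = p G̃(p)` of a relaxation modulus `G`. -/
def modulusQ (G : ℝ → ℝ) : PosReal → ℝ :=
  fun p => p * laplace G p

/-- The complex wave number function `κ(p) = ρ ^ (1/2) p / Q(p) ^ (1/2)` on `ℝ₊`, for the
density `ρ`. -/
def waveNumber (ρ : ℝ) (Q : PosReal → ℝ) : PosReal → ℝ :=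
  fun p => Real.sqrt ρ * p / Real.sqrt (Q p)

end Viscoelastic

end

noncomputable section

namespace Viscoelastic

open Filter Topology unitInterval

/-! Put `w = √p`. A nonzero function `f` is a CBF exactly when `f(w²) = w Φ(w)` for some `Φ`
holomorphic with positive real part on the right half-plane, and in this language the theorem is
about arguments. If `Q` corresponds to `Φ`, then `κ` corresponds to `√ρ (w/Φ)^(1/2)` and `κ/√p` to
`√ρ (1/(wΦ))^(1/2)`; these are geometric means of points of the half-plane and so stay in it.
Likewise `κ²/p = ρp/Q` corresponds to `ρ/Φ`.

Conversely, let `κ/√p` correspond to `Φ`. By the identity theorem `κ` corresponds to `wΦ`, so both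
`Φ` and `wΦ` have positive real part, while `Q` corresponds to `ρ/(wΦ²)`. What is needed is `|arg w
+ 2 arg Φ| ≤ π/2`. Pointwise one only gets the bound `π - |arg w|`, but this tends to `π/2` at the
boundary rays, and Phragmén–Lindelöf carries it inside (`abs_arg_add_two_mul_arg_le_pi_div_two`).

The dictionary passes through `harmonicMeans`, a compactified Stieltjes representation.
`CBF_subset_harmonicMeans` rests on Bernstein's theorem, itself derived from Hausdorff's moment
theorem; `harmonicMeans_subset_CBF` reads the representing measure as a Laplace transform. Each
harmonic kernel is visibly `w` times a function with positive real part, and the Poisson formula on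
the disc (`mem_harmonicMeans_of_positiveReal`) gives the way back. -/

/-- Measures of bounded mass on a compact space form a weakly compact set; a limit along an
ultrafilter replaces a convergent subsequence, so no metrizability is needed. -/
theorem exists_weak_limit {E : Type*} [MeasurableSpace E] [TopologicalSpace E] [T2Space E]
    [BorelSpace E] [CompactSpace E] (μ : ℕ → Measure E) [∀ n, IsFiniteMeasure (μ n)] (C : ℝ)
    (hC : ∀ n, (μ n).real univ ≤ C) :
    ∃ ν : Measure E, IsFiniteMeasure ν ∧ ∃ U : Filter ℕ, U.NeBot ∧ U ≤ atTop ∧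
      ∀ φ : E → ℝ, Continuous φ → Tendsto (fun n => ∫ y, φ y ∂μ n) U (𝓝 (∫ y, φ y ∂ν)) := by
  let m : ℕ → FiniteMeasure E := fun n => ⟨μ n, inferInstance⟩
  have hm : ∀ n, (m n).mass ≤ C.toNNReal := by
    intro n
    have h := Real.toNNReal_le_toNNReal (hC n)
    refine le_trans (le_of_eq ?_) h
    ext
    simp [m, FiniteMeasure.mass, Measure.real]
  have hK := isCompact_setOfPred_finiteMeasure_le_of_compactSpace E C.toNNReal
  let U : Ultrafilter ℕ := hyperfilter ℕ
  have hU : ((U.map m : Ultrafilter (FiniteMeasure E)) : Filter (FiniteMeasure E)) ≤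
      𝓟 {μ : FiniteMeasure E | μ.mass ≤ C.toNNReal} := by
    rw [le_principal_iff, Ultrafilter.coe_map, Filter.mem_map]
    exact Filter.univ_mem' hm
  obtain ⟨ν, -, hν⟩ := hK.ultrafilter_le_nhds _ hU
  refine ⟨ν, inferInstance, U, inferInstance, ?_, fun φ hφ => ?_⟩
  · exact (hyperfilter_le_cofinite).trans Nat.cofinite_eq_atTop.le
  · have h1 : Tendsto m U (𝓝 ν) := hν
    rw [FiniteMeasure.tendsto_iff_forall_integral_tendsto] at h1
    exact h1 (BoundedContinuousFunction.mkOfCompact ⟨φ, hφ⟩)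

/-! ### Completely monotonic functions: translates and differences -/

theorem IsCM.congr {f g : ℝ → ℝ} (hf : IsCM f) (h : EqOn g f (Ioi 0)) : IsCM g where
  contDiffOn := hf.contDiffOn.congr h
  nonneg n x hx := by
    rw [iteratedDerivWithin_congr h hx]
    exact hf.nonneg n x hx

theorem IsCM.nonneg_apply {f : ℝ → ℝ} (hf : IsCM f) {x : ℝ} (hx : 0 < x) : 0 ≤ f x := by
  simpa using hf.nonneg 0 x hx

theorem iteratedDerivWithin_comp_add (f : ℝ → ℝ) {a x : ℝ} (ha : 0 ≤ a) (hx : 0 < x) (n : ℕ) :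
    iteratedDerivWithin n (fun y => f (y + a)) (Ioi 0) x =
      iteratedDerivWithin n f (Ioi 0) (x + a) := by
  rw [iteratedDerivWithin_of_isOpen isOpen_Ioi hx,
    iteratedDerivWithin_of_isOpen isOpen_Ioi (show x + a ∈ Ioi 0 by simp; linarith),
    iteratedDeriv_comp_add_const]

theorem IsCM.comp_add {f : ℝ → ℝ} (hf : IsCM f) {a : ℝ} (ha : 0 ≤ a) :
    IsCM (fun x => f (x + a)) where
  contDiffOn := hf.contDiffOn.comp (by fun_prop) (fun x hx => by simp at hx ⊢; linarith)
  nonneg n x hx := by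
    rw [iteratedDerivWithin_comp_add f ha hx]
    exact hf.nonneg n _ (by linarith)

theorem IsCM.antitoneOn_iteratedDeriv {f : ℝ → ℝ} (hf : IsCM f) (n : ℕ) :
    AntitoneOn (fun x => (-1 : ℝ) ^ n * iteratedDerivWithin n f (Ioi 0) x) (Ioi 0) := by
  have hd : DifferentiableOn ℝ (iteratedDerivWithin n f (Ioi 0)) (Ioi 0) :=
    hf.contDiffOn.differentiableOn_iteratedDerivWithin (by exact_mod_cast ENat.natCast_lt_top n)
      (uniqueDiffOn_Ioi 0)
  refine antitoneOn_of_deriv_nonpos (convex_Ioi 0) ?_ ?_ ?_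
  · exact (hd.const_mul _).continuousOn
  · rw [interior_Ioi]; exact hd.const_mul _
  · intro x hx
    rw [interior_Ioi] at hx
    have h1 := hf.nonneg (n + 1) x hx
    rw [iteratedDerivWithin_succ, derivWithin_of_isOpen isOpen_Ioi hx] at h1
    rw [deriv_const_mul _ (hd.differentiableAt (isOpen_Ioi.mem_nhds hx))]
    rw [pow_succ] at h1
    linarith

theorem IsCM.antitoneOn {f : ℝ → ℝ} (hf : IsCM f) : AntitoneOn f (Ioi 0) := by
  simpa using hf.antitoneOn_iteratedDeriv 0

/-- Each `(-1)^n f^(n)` is decreasing, so it only drops under translation to the right. This is the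
source of positivity in the moment problem. -/
theorem IsCM.sub_comp_add {f : ℝ → ℝ} (hf : IsCM f) {a : ℝ} (ha : 0 ≤ a) :
    IsCM (fun x => f x - f (x + a)) where
  contDiffOn := hf.contDiffOn.sub (hf.comp_add ha).contDiffOn
  nonneg n x hx := by
    have h1 : iteratedDerivWithin n (fun x => f x - f (x + a)) (Ioi 0) x =
        iteratedDerivWithin n f (Ioi 0) x - iteratedDerivWithin n f (Ioi 0) (x + a) := by
      rw [← iteratedDerivWithin_comp_add f ha hx]
      refine iteratedDerivWithin_sub hx (uniqueDiffOn_Ioi 0) ?_ ?_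
      · exact (hf.contDiffOn.of_le (by exact_mod_cast le_top)) x hx
      · exact ((hf.comp_add ha).contDiffOn.of_le (by exact_mod_cast le_top)) x hx
    have h2 := hf.antitoneOn_iteratedDeriv n (show x ∈ Ioi 0 from hx)
      (show x + a ∈ Ioi (0 : ℝ) by simp; linarith) (by linarith)
    simp only at h2
    rw [h1, mul_sub]
    linarith

/-! ### Hausdorff's moment problem -/

section MomentProblem

open Polynomial

/-- The translation operator `f ↦ f (· + a)`. -/
def shiftOp (a : ℝ) : Module.End ℝ (ℝ → ℝ) where
  toFun f x := f (x + a)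
  map_add' _ _ := rfl
  map_smul' _ _ := rfl

theorem shiftOp_pow_apply (a : ℝ) (k : ℕ) (f : ℝ → ℝ) (x : ℝ) :
    (shiftOp a ^ k) f x = f (x + k * a) := by
  induction k generalizing x with
  | zero => simp
  | succ k ih =>
    rw [pow_succ', Module.End.mul_apply]
    change ((shiftOp a ^ k) f) (x + a) = _
    rw [ih]; push_cast; ring_nf

theorem isCM_shiftOp_pow {f : ℝ → ℝ} (hf : IsCM f) {a : ℝ} (ha : 0 ≤ a) (k m : ℕ) :
    IsCM (aeval (shiftOp a) ((X : ℝ[X]) ^ k * (1 - X) ^ m) f) := by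
  induction k with
  | zero =>
    induction m with
    | zero => simpa using hf
    | succ m ih =>
      have := ih.sub_comp_add ha
      convert this using 1
      rw [pow_succ' (1 - X : ℝ[X]), mul_left_comm, map_mul, Module.End.mul_apply]
      simp only [map_sub, map_one, aeval_X]
      rfl
  | succ k ih =>
    have := ih.comp_add ha
    convert this using 1
    rw [pow_succ', mul_assoc, map_mul, Module.End.mul_apply, aeval_X]
    rfl

/-- With the translation substituted for `X`, the product `X^k (1-X)^(n-k)` becomes translations and
differences, both of which preserve complete monotonicity. These values are the weights of the
approximating discrete measures. -/
theorem bernsteinPolynomial_nonneg_of_isCM {f : ℝ → ℝ} (hf : IsCM f) {a ε : ℝ} (ha : 0 ≤ a)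
    (hε : 0 < ε) (n k : ℕ) : 0 ≤ aeval (shiftOp a) (bernsteinPolynomial ℝ n k) f ε := by
  have h := (isCM_shiftOp_pow hf ha k (n - k)).nonneg_apply hε
  have : bernsteinPolynomial ℝ n k = (n.choose k : ℝ) • (X ^ k * (1 - X) ^ (n - k) : ℝ[X]) := by
    rw [bernsteinPolynomial, smul_eq_C_mul, mul_assoc]; simp
  rw [this, map_smul]
  exact mul_nonneg (Nat.cast_nonneg _) h

theorem X_pow_mul_bernsteinPolynomial (m j i : ℕ) :
    (X : ℝ[X]) ^ j * bernsteinPolynomial ℝ m i =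
      (((i + j).descFactorial j : ℝ) / (m + j).descFactorial j) •
        bernsteinPolynomial ℝ (m + j) (i + j) := by
  have hc : (m.choose i : ℝ) =
      ((i + j).descFactorial j : ℝ) / (m + j).descFactorial j * ((m + j).choose (i + j)) := by
    have h1 : ((m + j).descFactorial j : ℝ) ≠ 0 := by
      have := Nat.descFactorial_pos.2 (Nat.le_add_left j m)
      positivity
    rw [div_mul_eq_mul_div, eq_div_iff h1]
    have h3 := Nat.choose_mul (n := m + j) (k := i + j) (s := j) (by omega)
    simp only [Nat.add_sub_cancel] at h3
    rw [Nat.descFactorial_eq_factorial_mul_choose, Nat.descFactorial_eq_factorial_mul_choose]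
    have h4 : (((m + j).choose (i + j) * (i + j).choose j : ℕ) : ℝ)
       = ((m + j).choose j * m.choose i : ℕ) := by rw [h3]
    push_cast at h4 ⊢
    linear_combination (-(j.factorial : ℝ)) * h4
  have e : m + j - (i + j) = m - i := by omega
  simp only [bernsteinPolynomial, e, smul_eq_C_mul]
  rw [← map_natCast (C : ℝ →+* ℝ[X]) (m.choose i), hc, map_mul]
  simp only [map_natCast]
  ring

/-- The exact moment identity has falling-factorial ratios where `(k/n)^j` is wanted; the error is
`O(1/n)` uniformly in `k`. -/
theorem descFactorial_div_approx {n k : ℕ} (hk : k ≤ n) (j : ℕ) (hj : j ≤ n) :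
    0 ≤ ((k.descFactorial j : ℝ) / n.descFactorial j) ∧
    |((k.descFactorial j : ℝ) / n.descFactorial j) - ((k : ℝ) / n) ^ j| ≤ (j : ℝ) ^ 2 / n := by
  induction j with
  | zero => simp
  | succ j ih =>
    obtain ⟨h0, h2⟩ := ih (by omega)
    have hn : (0 : ℝ) < n := by exact_mod_cast (by omega : 0 < n)
    have hnj : (0 : ℝ) < (n - j : ℕ) := by exact_mod_cast (by omega : 0 < n - j)
    have e : (((k.descFactorial (j + 1) : ℕ) : ℝ) / n.descFactorial (j + 1)) =
        ((k - j : ℕ) / (n - j : ℕ) : ℝ) * ((k.descFactorial j : ℝ) / n.descFactorial j) := by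
      rw [Nat.descFactorial_succ, Nat.descFactorial_succ]; push_cast
      rw [div_mul_div_comm]
    have hkn : (k : ℝ) ≤ n := by exact_mod_cast hk
    have hr0 : (0 : ℝ) ≤ ((k - j : ℕ) : ℝ) / (n - j : ℕ) := by positivity
    have hr1 : ((k - j : ℕ) : ℝ) / (n - j : ℕ) ≤ 1 := by
      rw [div_le_one hnj]; exact_mod_cast (by omega)
    have hr : |((k - j : ℕ) : ℝ) / (n - j : ℕ) - (k : ℝ) / n| ≤ (j : ℝ) / n := by
      rcases le_or_gt j k with h | h
      · have hjk : (j : ℝ) ≤ k := by exact_mod_cast h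
        rw [Nat.cast_sub (by omega : j ≤ n)] at hnj ⊢
        rw [Nat.cast_sub h]
        have : ((k : ℝ) - j) / (n - j) - (k : ℝ) / n = -(((j : ℝ) / n) * ((n - k) / (n - j))) := by
          field_simp
          ring
        rw [this, abs_neg, abs_of_nonneg (mul_nonneg (by positivity)
          (div_nonneg (by linarith) hnj.le))]
        exact mul_le_of_le_one_right (by positivity) ((div_le_one hnj).2 (by linarith))
      · rw [Nat.sub_eq_zero_of_le h.le]
        simp only [Nat.cast_zero, zero_div, zero_sub, abs_neg]
        rw [abs_of_nonneg (by positivity)]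
        gcongr
    have hx1 : ((k : ℝ) / n) ^ j ≤ 1 := pow_le_one₀ (by positivity) ((div_le_one hn).2 hkn)
    refine ⟨by positivity, ?_⟩
    rw [e]
    set r := ((k - j : ℕ) : ℝ) / (n - j : ℕ)
    set u := ((k.descFactorial j : ℝ) / n.descFactorial j)
    set x := (k : ℝ) / n
    have hx0 : 0 ≤ x := by positivity
    calc |r * u - x ^ (j + 1)| = |r * (u - x ^ j) + x ^ j * (r - x)| := by congr 1; ring
      _ ≤ |r * (u - x ^ j)| + |x ^ j * (r - x)| := abs_add_le _ _
      _ = r * |u - x ^ j| + x ^ j * |r - x| := by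
        rw [abs_mul, abs_mul, abs_of_nonneg hr0, abs_of_nonneg (pow_nonneg hx0 j)]
      _ ≤ 1 * ((j : ℝ) ^ 2 / n) + 1 * (j / n) := by gcongr
      _ ≤ ((j + 1 : ℕ) : ℝ) ^ 2 / n := by
        rw [one_mul, one_mul, ← add_div]
        gcongr
        push_cast
        nlinarith [(Nat.cast_nonneg j : (0 : ℝ) ≤ j)]

/-- Multiply the partition of unity by Bernstein polynomials of degree `m` by `X^j`, re-expand in
degree `m + j`, and evaluate at the translation. The terms with `k < j` vanish with their falling
factorial. -/
theorem sum_bernsteinPolynomial_descFactorial (f : ℝ → ℝ) (a ε : ℝ) (m j : ℕ) :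
    ∑ k ∈ Finset.range (m + j + 1), ((k.descFactorial j : ℝ) / (m + j).descFactorial j) *
      aeval (shiftOp a) (bernsteinPolynomial ℝ (m + j) k) f ε = f (ε + j * a) := by
  have h1 : aeval (shiftOp a) ((X : ℝ[X]) ^ j) f ε = f (ε + j * a) := by
    rw [map_pow, aeval_X, shiftOp_pow_apply]
  have h2 : (X : ℝ[X]) ^ j = ∑ i ∈ Finset.range (m + 1), X ^ j * bernsteinPolynomial ℝ m i := by
    rw [← Finset.mul_sum, bernsteinPolynomial.sum, mul_one]
  rw [← h1, h2, map_sum, LinearMap.sum_apply, Finset.sum_apply,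
    show m + j + 1 = j + (m + 1) by ring, Finset.sum_range_add, Finset.sum_eq_zero, zero_add]
  · refine Finset.sum_congr rfl fun i _ => ?_
    rw [X_pow_mul_bernsteinPolynomial, map_smul, add_comm j i]
    rfl
  · intro k hk
    rw [Nat.descFactorial_of_lt (Finset.mem_range.1 hk)]
    simp

/-- Hausdorff's moment theorem for the values of a completely monotonic function along an
arithmetic progression. -/
theorem IsCM.exists_moment_measure {f : ℝ → ℝ} (hf : IsCM f) {a ε : ℝ} (ha : 0 ≤ a) (hε : 0 < ε) :
    ∃ ν : Measure I, IsFiniteMeasure ν ∧ ∀ j : ℕ, ∫ y, (y : ℝ) ^ j ∂ν = f (ε + j * a) := by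
  let D : ℕ → ℕ → ℝ := fun n k => aeval (shiftOp a) (bernsteinPolynomial ℝ n k) f ε
  have hD : ∀ n k, 0 ≤ D n k := fun n k => bernsteinPolynomial_nonneg_of_isCM hf ha hε n k
  have hsum : ∀ j m, ∑ k ∈ Finset.range (m + j + 1),
      ((k.descFactorial j : ℝ) / (m + j).descFactorial j) * D (m + j) k = f (ε + j * a) :=
    fun j m => sum_bernsteinPolynomial_descFactorial f a ε m j
  have hsum0 : ∀ n, ∑ k ∈ Finset.range (n + 1), D n k = f ε := fun n => by simpa using hsum 0 n
  -- The nodes are `k/n`; the projection only makes them points of `I` for all `k`.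
  let P : ℕ → ℕ → I := fun n k => projIcc 0 1 zero_le_one ((k : ℝ) / n)
  have hP : ∀ n k, k ≤ n → (P n k : ℝ) = (k : ℝ) / n := fun n k hk => by
    rw [show P n k = _ from projIcc_of_mem zero_le_one ⟨by positivity,
      div_le_one_of_le₀ (by exact_mod_cast hk) (by positivity)⟩]
  let μ : ℕ → Measure I := fun n =>
    ∑ k ∈ Finset.range (n + 1), ENNReal.ofReal (D n k) • Measure.dirac (P n k)
  have hfin : ∀ n, IsFiniteMeasure (μ n) := fun n => by
    refine ⟨?_⟩
    simp [μ, Measure.finsetSum_apply]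
  have hint : ∀ n (φ : I → ℝ), Continuous φ →
      ∫ y, φ y ∂μ n = ∑ k ∈ Finset.range (n + 1), D n k * φ (P n k) := by
    intro n φ hφ
    rw [integral_finsetSum_measure]
    · refine Finset.sum_congr rfl fun k _ => ?_
      rw [integral_smul_measure, integral_dirac, ENNReal.toReal_ofReal (hD n k), smul_eq_mul]
    · intro k _
      exact (integrable_dirac (by simp)).smul_measure ENNReal.ofReal_ne_top
  obtain ⟨ν, hν, U, hU, hUle, hlim⟩ := exists_weak_limit μ (f ε) (fun n => by
    have := hint n (fun _ => 1) continuous_const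
    simp only [integral_const, smul_eq_mul, mul_one] at this
    rw [this, hsum0])
  refine ⟨ν, hν, fun j => ?_⟩
  refine tendsto_nhds_unique (hlim (fun y => (y : ℝ) ^ j) (by fun_prop)) (Tendsto.mono_left ?_ hUle)
  have hb : Tendsto (fun n : ℕ => (j : ℝ) ^ 2 / n * f ε) atTop (𝓝 0) := by
    simpa using (tendsto_const_div_atTop_nhds_zero_nat ((j : ℝ) ^ 2)).mul_const (f ε)
  rw [tendsto_iff_norm_sub_tendsto_zero]
  refine squeeze_zero' (Eventually.of_forall fun n => norm_nonneg _) ?_ hb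
  filter_upwards [eventually_ge_atTop j] with n hn
  obtain ⟨m, rfl⟩ := Nat.exists_eq_add_of_le' hn
  rw [hint _ _ (by fun_prop), ← hsum j m, ← hsum0 (m + j), ← Finset.sum_sub_distrib,
    Finset.mul_sum, Real.norm_eq_abs]
  refine (Finset.abs_sum_le_sum_abs _ _).trans (Finset.sum_le_sum fun k hk => ?_)
  have hk' : k ≤ m + j := Nat.lt_succ_iff.1 (Finset.mem_range.1 hk)
  have h := (descFactorial_div_approx hk' j hn).2
  rw [hP _ _ hk', mul_comm (D _ _), ← sub_mul, abs_mul, abs_of_nonneg (hD _ _), abs_sub_comm]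
  exact mul_le_mul_of_nonneg_right h (hD _ _)

end MomentProblem

/-! ### Bernstein's theorem -/

theorem IsCM.continuousOn {f : ℝ → ℝ} (hf : IsCM f) : ContinuousOn f (Ioi 0) :=
  hf.contDiffOn.continuousOn

/-- Bernstein's theorem, for a translate of a completely monotonic function; the measure is
transported to the unit interval by `v = exp (-u)`. -/
theorem IsCM.exists_bernstein_measure {f : ℝ → ℝ} (hf : IsCM f) {ε : ℝ} (hε : 0 < ε) :
    ∃ ν : Measure I, IsFiniteMeasure ν ∧ ∀ t : ℝ, 0 < t → ∫ v, (v : ℝ) ^ t ∂ν = f (ε + t) := by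
  -- With mesh `1/N!`, every positive rational is a grid point for all large `N`.
  have h1 : ∀ N : ℕ, ∃ ν : Measure I, IsFiniteMeasure ν ∧
      ∀ j : ℕ, ∫ y, (y : ℝ) ^ j ∂ν = f (ε + j * (N.factorial : ℝ)⁻¹) := fun N =>
    hf.exists_moment_measure (by positivity) hε
  choose μ hμfin hμ using h1
  -- Substituting `v = y^(N!)` turns the moment of order `j` into that of order `j/N!`, so all the
  -- measures represent the same function.
  let T : ℕ → I → I := fun N y => y ^ N.factorial
  have hT : ∀ N, Measurable (T N) := fun N => (continuous_pow _).measurable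
  have hint : ∀ N (φ : I → ℝ), Continuous φ →
      ∫ y, φ y ∂((μ N).map (T N)) = ∫ y, φ (T N y) ∂μ N := fun N φ hφ =>
    integral_map (hT N).aemeasurable hφ.aestronglyMeasurable
  obtain ⟨ν, hν, U, hU, hUle, hlim⟩ := exists_weak_limit (fun N => (μ N).map (T N)) (f ε)
    (fun N => by
      have h := hμ N 0
      simp only [pow_zero, integral_const, smul_eq_mul, mul_one, Nat.cast_zero, zero_mul,
        add_zero] at h
      rw [measureReal_def, Measure.map_apply (hT N) MeasurableSet.univ, preimage_univ,
        ← measureReal_def, h])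
  have hcont : ∀ t : ℝ, 0 < t → Continuous fun v : I => (v : ℝ) ^ t := fun t ht =>
    (Real.continuous_rpow_const ht.le).comp continuous_subtype_val
  have hq : ∀ q : ℚ, 0 < q → ∫ v, (v : ℝ) ^ (q : ℝ) ∂ν = f (ε + q) := by
    intro q hq
    have hq' : (0 : ℝ) < q := by exact_mod_cast hq
    refine tendsto_nhds_unique (hlim _ (hcont q hq')) (Tendsto.mono_left ?_ hUle)
    refine tendsto_const_nhds.congr' ?_
    filter_upwards [eventually_ge_atTop q.den] with N hN
    obtain ⟨d, hd⟩ := Nat.dvd_factorial q.den_pos hN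
    rw [hint N _ (hcont q hq')]
    have hfac : ((N.factorial : ℕ) : ℝ) ≠ 0 := by positivity
    have hnum : ((q.num.toNat : ℕ) : ℝ) = (q : ℝ) * q.den := by
      have : ((q.num.toNat : ℤ) : ℚ) = q * q.den := by
        rw [Int.toNat_of_nonneg (Rat.num_pos.2 hq).le, Rat.mul_den_eq_num]
      exact_mod_cast this
    have hjq : ((q.num.toNat * d : ℕ) : ℝ) = N.factorial * q := by
      rw [hd]; push_cast; rw [hnum]; ring
    have := hμ N (q.num.toNat * d)
    rw [hjq, mul_comm (N.factorial : ℝ) (q : ℝ), mul_assoc, mul_inv_cancel₀ hfac, mul_one] at this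
    rw [← this]
    refine integral_congr_ae (Eventually.of_forall fun y => ?_)
    simp only [T, Set.Icc.coe_pow]
    rw [← Real.rpow_natCast, hjq, Real.rpow_mul y.2.1, Real.rpow_natCast]
  refine ⟨ν, hν, fun t ht => ?_⟩
  have hI : ContinuousOn (fun t : ℝ => ∫ v : I, (v : ℝ) ^ t ∂ν) (Ioi 0) := by
    intro t ht
    refine (continuousAt_of_dominated (bound := fun _ => 1) ?_ ?_ (integrable_const _)
      ?_).continuousWithinAt
    · filter_upwards [isOpen_Ioi.mem_nhds ht] with s hs
      exact (hcont s hs).aestronglyMeasurable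
    · filter_upwards [isOpen_Ioi.mem_nhds ht] with s hs
      refine Eventually.of_forall fun v => ?_
      rw [Real.norm_of_nonneg (Real.rpow_nonneg v.2.1 _)]
      exact Real.rpow_le_one v.2.1 v.2.2 (le_of_lt hs)
    · exact Eventually.of_forall fun v => Real.continuousAt_const_rpow' (ne_of_gt ht)
  have hJ : ContinuousOn (fun t : ℝ => f (ε + t)) (Ioi 0) :=
    hf.continuousOn.comp (by fun_prop) (fun t ht => by simp at ht ⊢; linarith)
  have hden : Ioi (0 : ℝ) ⊆ closure (Ioi 0 ∩ range ((↑) : ℚ → ℝ)) :=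
    (Rat.denseRange_cast (𝕜 := ℝ)).open_subset_closure_inter isOpen_Ioi
  have hEq : EqOn (fun t : ℝ => ∫ v : I, (v : ℝ) ^ t ∂ν) (fun t : ℝ => f (ε + t))
      (Ioi 0 ∩ range ((↑) : ℚ → ℝ)) := by
    rintro _ ⟨hx, q, rfl⟩
    exact hq q ((Rat.cast_pos (K := ℝ)).1 hx)
  exact hEq.of_subset_closure hI hJ inter_subset_left hden ht

/-! ### Integrals of harmonic means -/

/-- The weighted harmonic mean of `x` and `1`. -/
def harmonicKernel (x : ℝ) (s : I) : ℝ := x / ((1 - s) * x + s)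

theorem harmonicKernel_denom_pos {x : ℝ} (hx : 0 < x) (s : I) : 0 < (1 - (s : ℝ)) * x + s := by
  rcases eq_or_lt_of_le s.2.1 with h | h
  · rw [← h]; simpa
  · have := mul_nonneg (sub_nonneg.2 s.2.2) hx.le
    linarith

theorem continuous_harmonicKernel {x : ℝ} (hx : 0 < x) : Continuous (harmonicKernel x) :=
  Continuous.div (by fun_prop) (by fun_prop) fun s => (harmonicKernel_denom_pos hx s).ne'

/-- Integrals of weighted harmonic means of `x` and `1` with respect to the weight. -/
def harmonicMeans : Set (PosReal → ℝ) :=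
  {f | ∃ μ : Measure I, IsFiniteMeasure μ ∧ ∀ x : PosReal, f x = ∫ s, harmonicKernel x s ∂μ}

theorem mem_harmonicMeans_of_integral {Ω : Type*} [MeasurableSpace Ω] {m : Measure Ω} {S : Ω → I}
    (hS : Measurable S) {W : Ω → ℝ} (hW : Integrable W m) (hW0 : ∀ ω, 0 ≤ W ω) {f : PosReal → ℝ}
    (hf : ∀ x : PosReal, f x = ∫ ω, W ω * harmonicKernel x (S ω) ∂m) : f ∈ harmonicMeans := by
  have hfin : IsFiniteMeasure (m.withDensity fun ω => ENNReal.ofReal (W ω)) :=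
    isFiniteMeasure_withDensity_ofReal hW.2
  refine ⟨(m.withDensity fun ω => ENNReal.ofReal (W ω)).map S, inferInstance, fun x => ?_⟩
  rw [hf, integral_map hS.aemeasurable (continuous_harmonicKernel x.2).aestronglyMeasurable,
    integral_withDensity_eq_integral_toReal_smul₀ hW.1.aemeasurable.ennreal_ofReal
      (Eventually.of_forall fun _ => ENNReal.ofReal_lt_top)]
  refine integral_congr_ae (Eventually.of_forall fun ω => ?_)
  simp [ENNReal.toReal_ofReal (hW0 ω)]

theorem add_mem_harmonicMeans {f g : PosReal → ℝ} (hf : f ∈ harmonicMeans)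
    (hg : g ∈ harmonicMeans) : f + g ∈ harmonicMeans := by
  obtain ⟨μ, hμ, hf⟩ := hf
  obtain ⟨ν, hν, hg⟩ := hg
  refine ⟨μ + ν, inferInstance, fun x => ?_⟩
  rw [integral_add_measure, Pi.add_apply, hf, hg] <;>
  exact (continuous_harmonicKernel x.2).integrable_of_hasCompactSupport
    (HasCompactSupport.of_compactSpace _)

theorem const_mul_id_mem_harmonicMeans {c : ℝ} (hc : 0 ≤ c) :
    (fun x : PosReal => c * (x : ℝ)) ∈ harmonicMeans := by
  refine ⟨ENNReal.ofReal c • Measure.dirac 1, ⟨by simp⟩, fun x => ?_⟩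
  rw [integral_smul_measure, integral_dirac, ENNReal.toReal_ofReal hc]
  simp [harmonicKernel]

/-- The kernel is `1` at `x = 1`, so the value there is the total mass. Pointwise convergence thus
bounds the masses, and weak compactness applies because the kernel is continuous on all of `I`,
endpoints included. -/
theorem mem_harmonicMeans_of_tendsto {F : ℕ → PosReal → ℝ} {f : PosReal → ℝ}
    (hF : ∀ n, F n ∈ harmonicMeans) (hlim : ∀ x, Tendsto (fun n => F n x) atTop (𝓝 (f x))) :
    f ∈ harmonicMeans := by
  choose μ hμ hF using hF
  have hmass : ∀ n, (μ n).real univ = F n ⟨1, by simp⟩ := fun n => by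
    rw [hF]
    simp [harmonicKernel]
  obtain ⟨C, hC⟩ := (hlim ⟨1, by simp⟩).bddAbove_range
  obtain ⟨ν, hν, U, hU, hUle, hνlim⟩ := exists_weak_limit μ C fun n => by
    rw [hmass]; exact hC ⟨n, rfl⟩
  refine ⟨ν, hν, fun x => ?_⟩
  refine tendsto_nhds_unique ((hlim x).mono_left hUle) ?_
  simpa only [hF] using hνlim _ (continuous_harmonicKernel x.2)

/-! ### Laplace transforms and Bernstein functions -/

theorem IsCM.laplaceConverges {h : ℝ → ℝ} (hh : IsCM h) (hint : IntegrableOn h (Ioc 0 1)) {p : ℝ}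
    (hp : 0 < p) : LaplaceConverges h p := by
  have hE : Continuous fun t : ℝ => Real.exp (-(p * t)) := by fun_prop
  have h1 : IntegrableOn (fun t => h t * Real.exp (-(p * t))) (Ioc 0 1) := by
    refine Integrable.mul_bdd (c := 1) hint hE.aestronglyMeasurable ?_
    filter_upwards [ae_restrict_mem measurableSet_Ioc] with t ht
    rw [Real.norm_of_nonneg (Real.exp_nonneg _), Real.exp_le_one_iff]
    have := mul_pos hp ht.1
    linarith
  have h2 : IntegrableOn (fun t => h t * Real.exp (-(p * t))) (Ioi 1) := by
    have h3 := (integrableOn_exp_mul_Ioi (neg_neg_of_pos hp) 1).const_mul (h 1)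
    refine Integrable.mono' h3 ?_ ?_
    · refine ContinuousOn.aestronglyMeasurable ?_ measurableSet_Ioi
      exact (hh.continuousOn.mono (Ioi_subset_Ioi zero_le_one)).mul hE.continuousOn
    · filter_upwards [ae_restrict_mem measurableSet_Ioi] with t ht
      have ht0 : (0 : ℝ) < t := zero_lt_one.trans ht
      rw [Real.norm_of_nonneg (mul_nonneg (hh.nonneg_apply ht0) (Real.exp_nonneg _)), neg_mul]
      exact mul_le_mul_of_nonneg_right
        (hh.antitoneOn (show (1 : ℝ) ∈ Ioi 0 by simp) ht0 (le_of_lt ht)) (Real.exp_nonneg _)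
  unfold LaplaceConverges
  rw [← Ioc_union_Ioi_eq_Ioi (zero_le_one : (0 : ℝ) ≤ 1)]
  exact h1.union h2

theorem LaplaceConverges.integrableOn_Ioc {h : ℝ → ℝ} {p : ℝ} (hh : LaplaceConverges h p) (T : ℝ) :
    IntegrableOn h (Ioc 0 T) := by
  have hE : Continuous fun t : ℝ => Real.exp (p * t) := by fun_prop
  obtain ⟨C, hC⟩ := isCompact_Icc.exists_bound_of_continuousOn (s := Icc 0 T) hE.continuousOn
  have h1 : IntegrableOn (fun t => h t * Real.exp (-(p * t)) * Real.exp (p * t)) (Ioc 0 T) := by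
    refine Integrable.mul_bdd (c := C) (hh.mono_set Ioc_subset_Ioi_self)
      hE.aestronglyMeasurable ?_
    filter_upwards [ae_restrict_mem measurableSet_Ioc] with t ht using hC t ⟨ht.1.le, ht.2⟩
  refine h1.congr_fun (fun t _ => ?_) measurableSet_Ioc
  simp only
  rw [mul_assoc, ← Real.exp_add]
  simp

theorem exists_bound_of_hasDerivAt_isCM {g h : ℝ → ℝ} (hh : IsCM h) (hg0 : ∀ x, 0 ≤ x → 0 ≤ g x)
    (hgc : ContinuousOn g (Ici 0)) (hgd : ∀ t, 0 < t → HasDerivAt g (h t) t) {b : ℝ} (hb : 0 < b) :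
    ∃ K, ∀ t, 0 ≤ t → |g t| ≤ K * Real.exp (b * t) := by
  have h1 := hh.nonneg_apply one_pos
  have hmono : MonotoneOn g (Ici 0) := by
    refine monotoneOn_of_deriv_nonneg (convex_Ici 0) hgc ?_ ?_ <;> rw [interior_Ici]
    · exact fun t ht => (hgd t ht).differentiableAt.differentiableWithinAt
    · exact fun t ht => (hgd t ht).deriv ▸ hh.nonneg_apply ht
  refine ⟨g 1 + h 1 / b, fun t ht => ?_⟩
  rw [abs_of_nonneg (hg0 t ht)]
  have hlin : g t ≤ g 1 + h 1 * t := by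
    rcases le_total t 1 with h' | h'
    · have := hmono ht (show (1 : ℝ) ∈ Ici 0 by simp) h'
      nlinarith
    · have := (convex_Ici (1 : ℝ)).image_sub_le_mul_sub_of_deriv_le (f := g) (C := h 1)
        (hgc.mono (Ici_subset_Ici.2 zero_le_one)) ?_ ?_ 1 (by simp) t h' h'
      · nlinarith
      · rw [interior_Ici]
        exact fun s hs => (hgd s (zero_lt_one.trans hs)).differentiableAt.differentiableWithinAt
      · rw [interior_Ici]
        intro s hs
        have hs0 : (0 : ℝ) < s := zero_lt_one.trans hs
        rw [(hgd s hs0).deriv]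
        exact hh.antitoneOn (show (1 : ℝ) ∈ Ioi 0 by simp) hs0 (le_of_lt hs)
  have he := Real.add_one_le_exp (b * t)
  have hbt : 0 ≤ b * t := by positivity
  have e1 : h 1 * t = h 1 / b * (b * t) := by field_simp
  have e2 := mul_le_mul_of_nonneg_left (show b * t ≤ Real.exp (b * t) by linarith)
    (show 0 ≤ h 1 / b by positivity)
  have e3 := mul_le_mul_of_nonneg_left (show 1 ≤ Real.exp (b * t) by linarith) (hg0 1 zero_le_one)
  rw [add_mul]
  linarith

/-- Integration by parts; the boundary term at infinity vanishes because `g` grows more slowly than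
`exp (p t / 2)`. -/
theorem mul_laplace_of_hasDerivAt {g h : ℝ → ℝ} (hh : IsCM h) (hg0 : ∀ x, 0 ≤ x → 0 ≤ g x)
    (hgc : ContinuousOn g (Ici 0)) (hgd : ∀ t, 0 < t → HasDerivAt g (h t) t) {p : ℝ} (hp : 0 < p)
    (hL : LaplaceConverges h p) : p * laplace g p = g 0 + laplace h p := by
  obtain ⟨K, hK⟩ := exists_bound_of_hasDerivAt_isCM hh hg0 hgc hgd (half_pos hp)
  have hE : Continuous fun t : ℝ => Real.exp (-(p * t)) := by fun_prop
  have hbd : ∀ t, 0 ≤ t → ‖g t * Real.exp (-(p * t))‖ ≤ K * Real.exp (-(p / 2) * t) := by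
    intro t ht
    rw [norm_mul, Real.norm_eq_abs, Real.norm_of_nonneg (Real.exp_nonneg _)]
    have he : Real.exp (p / 2 * t) * Real.exp (-(p * t)) = Real.exp (-(p / 2) * t) := by
      rw [← Real.exp_add]
      congr 1
      ring
    rw [← he, ← mul_assoc]
    exact mul_le_mul_of_nonneg_right (hK t ht) (Real.exp_nonneg _)
  have hLg : LaplaceConverges g p := by
    refine Integrable.mono' ((integrableOn_exp_mul_Ioi (by linarith : -(p / 2) < 0) 0).const_mul K)
      ?_ ?_
    · exact ((hgc.mono Ioi_subset_Ici_self).mul hE.continuousOn).aestronglyMeasurable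
        measurableSet_Ioi
    · filter_upwards [ae_restrict_mem measurableSet_Ioi] with t ht using hbd t (le_of_lt ht)
  have hlim : Tendsto (fun t => g t * Real.exp (-(p * t))) atTop (𝓝 0) := by
    refine squeeze_zero_norm' ?_ (a := fun t => K * Real.exp (-(p / 2) * t)) ?_
    · filter_upwards [eventually_ge_atTop 0] with t ht using hbd t ht
    · rw [← mul_zero K]
      refine (Real.tendsto_exp_atBot.comp ?_).const_mul K
      exact tendsto_id.const_mul_atTop_of_neg (by linarith)
  have hderiv : ∀ t ∈ Ioi (0 : ℝ), HasDerivAt (fun t => g t * Real.exp (-(p * t)))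
      (h t * Real.exp (-(p * t)) - p * (g t * Real.exp (-(p * t)))) t := by
    intro t ht
    have he : HasDerivAt (fun t => Real.exp (-(p * t))) (Real.exp (-(p * t)) * (-(p * 1))) t :=
      ((hasDerivAt_id t).const_mul p).neg.exp
    exact ((hgd t ht).mul he).congr_deriv (by ring)
  have h4 := integral_Ioi_of_hasDerivAt_of_tendsto
    ((hgc.mul hE.continuousOn) 0 self_mem_Ici) hderiv (hL.sub (hLg.const_mul p)) hlim
  rw [integral_sub hL (hLg.const_mul p), integral_const_mul] at h4
  simp only [Pi.mul_apply, mul_zero, neg_zero, Real.exp_zero, mul_one] at h4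
  unfold laplace
  linarith

theorem isCM_primitive {h : ℝ → ℝ} (hh : IsCM h) (hL : LaplaceConverges h 1) {c : ℝ} (hc : 0 ≤ c) :
    ∃ g : ℝ → ℝ, IsBernstein g ∧ g 0 = c ∧ ∀ t, 0 < t → HasDerivAt g (h t) t := by
  -- Off `]0, ∞[` nothing is known about `h`; cutting it off makes the primitive continuous on the
  -- whole line.
  let k : ℝ → ℝ := (Ioi 0).indicator h
  have hk0 : ∀ t, 0 ≤ k t := fun t => indicator_nonneg (fun s hs => hh.nonneg_apply hs) t
  have hk : ∀ a b, IntervalIntegrable k volume a b := by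
    have h0 : ∀ b, IntervalIntegrable k volume 0 b := by
      intro b
      rcases le_total 0 b with hb | hb
      · rw [intervalIntegrable_iff_integrableOn_Ioc_of_le hb]
        exact (hL.integrableOn_Ioc b).congr_fun
          (fun t ht => (indicator_of_mem (show t ∈ Ioi (0 : ℝ) from ht.1) h).symm) measurableSet_Ioc
      · refine IntervalIntegrable.symm ?_
        rw [intervalIntegrable_iff_integrableOn_Ioc_of_le hb]
        refine (integrableOn_zero).congr_fun
          (fun t ht => (indicator_of_notMem (fun h' => ?_) h).symm) measurableSet_Ioc
        exact not_lt_of_ge ht.2 h'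
    exact fun a b => (h0 a).symm.trans (h0 b)
  have hcont : Continuous fun t => c + ∫ s in (0 : ℝ)..t, k s :=
    continuous_const.add (intervalIntegral.continuous_primitive hk 0)
  have hd : ∀ t, 0 < t → HasDerivAt (fun t => c + ∫ s in (0 : ℝ)..t, k s) (h t) t := by
    intro t ht
    have heq : k =ᶠ[𝓝 t] h := by
      filter_upwards [isOpen_Ioi.mem_nhds ht] with s hs using indicator_of_mem hs h
    have hkc : ContinuousOn k (Ioi 0) :=
      hh.continuousOn.congr fun s hs => indicator_of_mem hs h
    have := intervalIntegral.integral_hasDerivAt_right (hk 0 t)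
      (hkc.stronglyMeasurableAtFilter isOpen_Ioi t ht) (hkc.continuousAt (isOpen_Ioi.mem_nhds ht))
    rw [show k t = h t from heq.eq_of_nhds] at this
    exact this.const_add c
  refine ⟨fun t => c + ∫ s in (0 : ℝ)..t, k s, ⟨?_, hcont.continuousOn, ?_, ?_⟩, by simp, hd⟩
  · exact fun t ht => add_nonneg hc (intervalIntegral.integral_nonneg ht fun s _ => hk0 s)
  · exact fun t ht => (hd t ht).differentiableAt.differentiableWithinAt
  · exact hh.congr fun t ht => (hd t ht).deriv

/-- The data are `c = g 0` and `h = g'` for the Bernstein function `g`, recovered as a primitive. -/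
theorem mem_CBF_iff {f : PosReal → ℝ} :
    f ∈ CBF ↔ ∃ c : ℝ, 0 ≤ c ∧ ∃ h : ℝ → ℝ, IsCM h ∧ (∀ p, 0 < p → LaplaceConverges h p) ∧
      ∀ x : PosReal, f x = c * x + x * laplace h x := by
  constructor
  · rintro ⟨g, hg, hf⟩
    have hd : ∀ t, 0 < t → HasDerivAt g (deriv g t) t := fun t ht =>
      (hg.differentiableOn.differentiableAt (isOpen_Ioi.mem_nhds ht)).hasDerivAt
    -- A nonnegative derivative of a function continuous up to `0` is automatically integrable
    -- there.
    have hint : IntegrableOn (deriv g) (Ioc 0 1) :=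
      intervalIntegral.integrableOn_deriv_of_nonneg (hg.continuousOn.mono Icc_subset_Ici_self)
        (fun t ht => hd t ht.1) fun t ht => hg.deriv_isCM.nonneg_apply ht.1
    have hL : ∀ p, 0 < p → LaplaceConverges (deriv g) p := fun p hp =>
      hg.deriv_isCM.laplaceConverges hint hp
    refine ⟨g 0, hg.nonneg 0 le_rfl, deriv g, hg.deriv_isCM, hL, fun x => ?_⟩
    have := mul_laplace_of_hasDerivAt hg.deriv_isCM hg.nonneg hg.continuousOn hd x.2 (hL x x.2)
    rw [hf]
    linear_combination (x : ℝ) * this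
  · rintro ⟨c, hc, h, hh, hL, hf⟩
    obtain ⟨g, hg, hg0, hd⟩ := isCM_primitive hh (hL 1 one_pos) hc
    refine ⟨g, hg, fun x => ?_⟩
    have := mul_laplace_of_hasDerivAt hh hg.nonneg hg.continuousOn hd x.2 (hL x x.2)
    rw [hf, ← hg0]
    linear_combination (-(x : ℝ)) * this

/-! ### Complete Bernstein functions are the integrals of harmonic means -/

/-- With `v = exp (-u)`, `x` times the Laplace transform of `v^t` is `x/(x + u)`, which is `1/(1 +
u)` times the harmonic kernel of weight `u/(1 + u)`. The translation by `ε` makes the Bernstein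
measure finite. -/
theorem mul_laplace_comp_add_mem_harmonicMeans {h : ℝ → ℝ} (hh : IsCM h) {ε : ℝ} (hε : 0 < ε) :
    (fun x : PosReal => (x : ℝ) * laplace (fun t => h (ε + t)) x) ∈ harmonicMeans := by
  obtain ⟨ν, hν, hνh⟩ := hh.exists_bernstein_measure hε
  have hlog : ∀ v : I, Real.log v ≤ 0 := fun v => Real.log_nonpos v.2.1 v.2.2
  -- The point `v = 0`, that is `u = ∞`, contributes nothing for `t > 0`: its weight `W` is `0` and
  -- the value of `S` there is immaterial.
  let S : I → I := fun v => if (v : ℝ) = 0 then 1 else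
    ⟨-Real.log v / (1 - Real.log v), div_nonneg (by linarith [hlog v]) (by linarith [hlog v]),
      (div_le_one (by linarith [hlog v])).2 (by linarith)⟩
  let W : I → ℝ := fun v => if (v : ℝ) = 0 then 0 else 1 / (1 - Real.log v)
  have hms : MeasurableSet {v : I | (v : ℝ) = 0} :=
    measurableSet_eq_fun measurable_subtype_coe measurable_const
  have hmlog : Measurable fun v : I => Real.log v := Real.measurable_log.comp measurable_subtype_coe
  have hS : Measurable S := by
    refine Measurable.ite hms measurable_const (Measurable.subtype_mk ?_)
    exact hmlog.neg.div (measurable_const.sub hmlog)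
  have hWm : Measurable W :=
    Measurable.ite hms measurable_const (measurable_const.div (measurable_const.sub hmlog))
  have hW0 : ∀ v, 0 ≤ W v := by
    intro v
    simp only [W]
    split_ifs
    · rfl
    · exact div_nonneg zero_le_one (by linarith [hlog v])
  have hW1 : ∀ v, W v ≤ 1 := by
    intro v
    simp only [W]
    split_ifs
    · exact zero_le_one
    · exact (div_le_one (by linarith [hlog v])).2 (by linarith [hlog v])
  have hWi : Integrable W ν := by
    refine Integrable.mono' (integrable_const 1) hWm.aestronglyMeasurable
      (Eventually.of_forall fun v => ?_)
    rw [Real.norm_of_nonneg (hW0 v)]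
    exact hW1 v
  refine mem_harmonicMeans_of_integral hS hWi hW0 fun x => ?_
  have hx : (0 : ℝ) < x := x.2
  have hkey : ∀ v : I, x * ∫ t in Ioi (0 : ℝ), (v : ℝ) ^ t * Real.exp (-(x * t)) =
      W v * harmonicKernel x (S v) := by
    intro v
    by_cases hv : (v : ℝ) = 0
    · rw [setIntegral_congr_fun measurableSet_Ioi (g := fun _ => 0)]
      · have hv' : v = 0 := Subtype.ext hv
        simp [W, hv']
      · intro t ht
        simp only [hv, Real.zero_rpow (ne_of_gt ht), zero_mul]
    · have hv0 : 0 < (v : ℝ) := lt_of_le_of_ne v.2.1 (Ne.symm hv)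
      have hl := hlog v
      rw [setIntegral_congr_fun measurableSet_Ioi
        (g := fun t => Real.exp ((Real.log v - x) * t))]
      · rw [integral_exp_mul_Ioi (by linarith)]
        simp only [W, S, hv, if_false, harmonicKernel, mul_zero, Real.exp_zero]
        have h1 : 1 - Real.log v ≠ 0 := by linarith
        have h2 : Real.log v - x ≠ 0 := by linarith
        have h3 : x - Real.log v ≠ 0 := by linarith
        have h4 : (1 - -Real.log v / (1 - Real.log v)) * (x : ℝ) +
            -Real.log v / (1 - Real.log v) = (x - Real.log v) / (1 - Real.log v) := by
          field_simp
          ring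
        rw [h4]
        field_simp
        ring
      · intro t _
        simp only
        rw [Real.rpow_def_of_pos hv0, ← Real.exp_add]
        congr 1
        ring
  have hint : Integrable (Function.uncurry fun (t : ℝ) (v : I) =>
      (v : ℝ) ^ t * Real.exp (-(x * t))) ((volume.restrict (Ioi 0)).prod ν) := by
    have h1 : Integrable (fun z : ℝ × I => Real.exp (-x * z.1) * 1)
        ((volume.restrict (Ioi 0)).prod ν) :=
      (integrableOn_exp_mul_Ioi (neg_neg_of_pos hx) 0).mul_prod (integrable_const 1)
    refine Integrable.mono' h1 ?_ ?_
    · refine Measurable.aestronglyMeasurable ?_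
      exact ((measurable_subtype_coe.comp measurable_snd).pow measurable_fst).mul
        (by fun_prop)
    · have : ∀ᵐ z : ℝ × I ∂((volume.restrict (Ioi 0)).prod ν), z.1 ∈ Ioi (0 : ℝ) :=
        Measure.quasiMeasurePreserving_fst.ae (ae_restrict_mem measurableSet_Ioi)
      filter_upwards [this] with z hz
      have h2 : ((z.2 : ℝ)) ^ z.1 ≤ 1 := Real.rpow_le_one z.2.2.1 z.2.2.2 (le_of_lt hz)
      have h3 : 0 ≤ ((z.2 : ℝ)) ^ z.1 := Real.rpow_nonneg z.2.2.1 _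
      simp only [Function.uncurry]
      rw [Real.norm_of_nonneg (mul_nonneg h3 (Real.exp_nonneg _)), mul_one, neg_mul]
      exact mul_le_of_le_one_left (Real.exp_nonneg _) h2
  calc (x : ℝ) * laplace (fun t => h (ε + t)) x
      = x * ∫ t in Ioi (0 : ℝ), ∫ v : I, (v : ℝ) ^ t * Real.exp (-(x * t)) ∂ν := by
        unfold laplace
        congr 1
        refine setIntegral_congr_fun measurableSet_Ioi fun t ht => ?_
        simp only
        rw [integral_mul_const, hνh t ht]
    _ = ∫ v : I, (x * ∫ t in Ioi (0 : ℝ), (v : ℝ) ^ t * Real.exp (-(x * t))) ∂ν := by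
        rw [integral_integral_swap hint, integral_const_mul]
    _ = ∫ v, W v * harmonicKernel x (S v) ∂ν :=
        integral_congr_ae (Eventually.of_forall hkey)

/-- Let `ε = 1/(n+1)` tend to `0`. As `h` is decreasing, its translates are dominated by `h`. -/
theorem mul_laplace_mem_harmonicMeans {h : ℝ → ℝ} (hh : IsCM h)
    (hL : ∀ p, 0 < p → LaplaceConverges h p) :
    (fun x : PosReal => (x : ℝ) * laplace h x) ∈ harmonicMeans := by
  refine mem_harmonicMeans_of_tendsto
    (fun n : ℕ => mul_laplace_comp_add_mem_harmonicMeans hh (Nat.one_div_pos_of_nat (n := n)))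
    fun x => Tendsto.const_mul _ ?_
  have hx : (0 : ℝ) < x := x.2
  refine tendsto_integral_of_dominated_convergence _ ?_ (hL x x.2) ?_ ?_
  · intro n
    have hn : (0 : ℝ) < 1 / (n + 1) := Nat.one_div_pos_of_nat
    refine ContinuousOn.aestronglyMeasurable ?_ measurableSet_Ioi
    refine ContinuousOn.mul ?_ (by fun_prop)
    exact hh.continuousOn.comp (by fun_prop) fun t ht => by
      have ht' : (0 : ℝ) < t := ht
      exact add_pos hn ht'
  · intro n
    have hn : (0 : ℝ) < 1 / (n + 1) := Nat.one_div_pos_of_nat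
    filter_upwards [ae_restrict_mem measurableSet_Ioi] with t ht
    have ht' : (0 : ℝ) < t := ht
    have h1 : (0 : ℝ) < 1 / (n + 1) + t := by linarith
    rw [Real.norm_of_nonneg (mul_nonneg (hh.nonneg_apply h1) (Real.exp_nonneg _))]
    exact mul_le_mul_of_nonneg_right (hh.antitoneOn ht' h1 (by linarith)) (Real.exp_nonneg _)
  · filter_upwards [ae_restrict_mem measurableSet_Ioi] with t ht
    refine Tendsto.mul_const _ ?_
    have hc := (hh.continuousOn.continuousAt (isOpen_Ioi.mem_nhds ht)).tendsto
    refine hc.comp ?_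
    simpa using (tendsto_one_div_add_atTop_nhds_zero_nat (𝕜 := ℝ)).add_const t

theorem CBF_subset_harmonicMeans : CBF ⊆ harmonicMeans := by
  intro f hf
  obtain ⟨c, hc, h, hh, hL, hf⟩ := mem_CBF_iff.1 hf
  rw [show f = (fun x : PosReal => c * (x : ℝ)) + fun x : PosReal => (x : ℝ) * laplace h x from
    funext hf]
  exact add_mem_harmonicMeans (const_mul_id_mem_harmonicMeans hc)
    (mul_laplace_mem_harmonicMeans hh hL)

open ProbabilityTheory in
theorem isCM_mgf {Ω : Type*} [MeasurableSpace Ω] {m : Measure Ω} {X : Ω → ℝ} (hX : ∀ ω, X ω ≤ 0)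
    (hint : Ioi 0 ⊆ integrableExpSet X m) : IsCM (mgf X m) := by
  have hsub : Ioi 0 ⊆ interior (integrableExpSet X m) := interior_maximal hint isOpen_Ioi
  refine ⟨((analyticOnNhd_mgf.mono hsub).contDiffOn (uniqueDiffOn_Ioi 0)), fun n x hx => ?_⟩
  rw [iteratedDerivWithin_of_isOpen isOpen_Ioi hx, iteratedDeriv_mgf (hsub hx),
    ← integral_const_mul]
  refine integral_nonneg fun ω => ?_
  simp only
  rw [← mul_assoc, ← mul_pow]
  exact mul_nonneg (pow_nonneg (by linarith [hX ω]) n) (Real.exp_nonneg _)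

/-- The atom at `s = 1` gives the linear term. For `s < 1` the kernel is `x d/(u + x)` with `u =
s/(1-s)` and `d = 1/(1-s)`, which is `x` times the Laplace transform of `d exp (-u t)`; integrating
over `s` gives a moment generating function of `-u ≤ 0`. -/
theorem harmonicMeans_subset_CBF : harmonicMeans ⊆ CBF := by
  rintro f ⟨μ, hμ, hf⟩
  -- Division by zero gives `d 1 = u 1 = 0`, so the atom at `1` drops out of the density.
  let d : I → ℝ := fun s => 1 / (1 - s)
  let u : I → ℝ := fun s => s / (1 - s)
  have hs1 : ∀ s : I, 0 ≤ 1 - (s : ℝ) := fun s => sub_nonneg.2 s.2.2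
  have hd0 : ∀ s, 0 ≤ d s := fun s => div_nonneg zero_le_one (hs1 s)
  have hu0 : ∀ s, 0 ≤ u s := fun s => div_nonneg s.2.1 (hs1 s)
  have hdm : Measurable d := by fun_prop
  have hum : Measurable u := by fun_prop
  have hdu : ∀ s, d s ≤ 1 + u s := by
    intro s
    rcases eq_or_lt_of_le (hs1 s) with h | h
    · simp [d, u, ← h]
    · refine le_of_eq ?_
      simp only [d, u]
      field_simp
      ring
  let X : I → ℝ := fun s => -u s
  let m : Measure I := μ.withDensity fun s => ENNReal.ofReal (d s)
  -- The density `d` may fail to be integrable, but `d ≤ 1 + u` and `t u exp (-t u) ≤ 1`.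
  have hbd : ∀ t : ℝ, 0 < t → ∀ s, ‖d s * Real.exp (t * X s)‖ ≤ 1 + 1 / t := by
    intro t ht s
    rw [Real.norm_of_nonneg (mul_nonneg (hd0 s) (Real.exp_nonneg _))]
    have h1 : Real.exp (t * X s) ≤ 1 := by
      rw [Real.exp_le_one_iff]
      have := mul_nonneg ht.le (hu0 s)
      simp only [X]; linarith
    have h2 : t * u s * Real.exp (t * X s) ≤ 1 := by
      have h3 := Real.add_one_le_exp (t * u s)
      have h4 : Real.exp (t * u s) * Real.exp (t * X s) = 1 := by
        rw [← Real.exp_add]; simp [X]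
      nlinarith [Real.exp_nonneg (t * X s)]
    have h5 : u s * Real.exp (t * X s) ≤ 1 / t := by
      rw [le_div_iff₀ ht]; linarith
    have h6 := mul_le_mul_of_nonneg_right (hdu s) (Real.exp_nonneg (t * X s))
    linarith
  have hint : Ioi 0 ⊆ ProbabilityTheory.integrableExpSet X m := by
    intro t ht
    change Integrable _ m
    rw [integrable_withDensity_iff_integrable_smul' (by fun_prop)
      (Eventually.of_forall fun _ => ENNReal.ofReal_lt_top)]
    refine Integrable.mono' (integrable_const (1 + 1 / t)) ?_
      (Eventually.of_forall fun s => ?_)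
    · exact Measurable.aestronglyMeasurable (by fun_prop)
    · rw [ENNReal.toReal_ofReal (hd0 s)]
      exact hbd t ht s
  have hcm := isCM_mgf (X := X) (m := m) (fun s => by simpa [X] using hu0 s) hint
  have hmgf : ∀ t, ProbabilityTheory.mgf X m t = ∫ s, d s * Real.exp (t * X s) ∂μ := by
    intro t
    rw [ProbabilityTheory.mgf, integral_withDensity_eq_integral_toReal_smul₀ (by fun_prop)
      (Eventually.of_forall fun _ => ENNReal.ofReal_lt_top)]
    exact integral_congr_ae (Eventually.of_forall fun s => by
      simp [ENNReal.toReal_ofReal (hd0 s)])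
  let Φ : ℝ → I × ℝ → ℝ := fun x z => d z.1 * Real.exp (z.2 * X z.1) * Real.exp (-(x * z.2))
  have hΦ : ∀ x (s : I), (fun t => Φ x (s, t)) = fun t => d s * Real.exp (-(u s + x) * t) := by
    intro x s
    ext t
    simp only [Φ, X]
    rw [mul_assoc, ← Real.exp_add]
    congr 2
    ring
  have hΦi : ∀ x, 0 < x → ∀ s, IntegrableOn (fun t => Φ x (s, t)) (Ioi 0) := by
    intro x hx s
    rw [hΦ]
    exact (integrableOn_exp_mul_Ioi (by linarith [hu0 s]) 0).const_mul _
  have hΦv : ∀ x, 0 < x → ∀ s, ∫ t in Ioi (0 : ℝ), Φ x (s, t) = d s / (u s + x) := by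
    intro x hx s
    rw [hΦ, integral_const_mul, integral_exp_mul_Ioi (by linarith [hu0 s])]
    rw [mul_zero, Real.exp_zero, neg_div_neg_eq, mul_one_div]
  have hΦ0 : ∀ x z, 0 ≤ Φ x z := fun x z =>
    mul_nonneg (mul_nonneg (hd0 _) (Real.exp_nonneg _)) (Real.exp_nonneg _)
  have hΦm : ∀ x, Measurable (Φ x) := by
    intro x
    simp only [Φ, X]
    fun_prop
  have hker : ∀ x, 0 < x → ∀ s : I, harmonicKernel x s =
      ({1} : Set I).indicator (fun _ => x) s + x * (d s / (u s + x)) := by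
    intro x hx s
    by_cases hs : s = 1
    · simp [hs, harmonicKernel, d]
    · have hs' : (s : ℝ) < 1 := lt_of_le_of_ne s.2.2 fun h => hs (Subtype.ext h)
      have h1 : (1 - (s : ℝ)) ≠ 0 := by linarith
      have h2 := harmonicKernel_denom_pos hx s
      rw [indicator_of_notMem (by simpa using hs), zero_add]
      simp only [harmonicKernel, d, u]
      have h3 : (s : ℝ) / (1 - s) + x = ((1 - s) * x + s) / (1 - s) := by
        field_simp
        ring
      rw [h3]
      field_simp
  have hki : ∀ x, 0 < x → Integrable (fun s => d s / (u s + x)) μ := by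
    intro x hx
    have h1 : Integrable (harmonicKernel x) μ :=
      (continuous_harmonicKernel hx).integrable_of_hasCompactSupport
        (HasCompactSupport.of_compactSpace _)
    have h2 : Integrable (({1} : Set I).indicator fun _ => x) μ :=
      (integrable_const x).indicator (measurableSet_singleton 1)
    refine ((h1.sub h2).const_mul x⁻¹).congr (Eventually.of_forall fun s => ?_)
    simp only [Pi.sub_apply, hker x hx, add_sub_cancel_left]
    field_simp
  have hprod : ∀ x, 0 < x → Integrable (Φ x) (μ.prod (volume.restrict (Ioi 0))) := by
    intro x hx
    rw [integrable_prod_iff (hΦm x).aestronglyMeasurable]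
    refine ⟨Eventually.of_forall fun s => hΦi x hx s, ?_⟩
    refine (hki x hx).congr (Eventually.of_forall fun s => ?_)
    simp only [Real.norm_of_nonneg (hΦ0 x _), hΦv x hx]
  have hsl : ∀ x t, ∫ s, Φ x (s, t) ∂μ =
      ProbabilityTheory.mgf X m t * Real.exp (-(x * t)) := by
    intro x t
    rw [hmgf, ← integral_mul_const]
  refine mem_CBF_iff.2 ⟨μ.real {1}, measureReal_nonneg, ProbabilityTheory.mgf X m, hcm,
    fun p hp => ?_, fun x => ?_⟩
  · have := (hprod p hp).integral_prod_right
    simp only [hsl] at this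
    exact this
  · have hx : (0 : ℝ) < x := x.2
    have hlap : laplace (ProbabilityTheory.mgf X m) x = ∫ s, d s / (u s + x) ∂μ := by
      have := integral_integral_swap (f := fun s t => Φ x (s, t)) (hprod x hx)
      simp only [hsl, hΦv x hx] at this
      exact this.symm
    rw [hf, hlap, ← integral_const_mul, integral_congr_ae (Eventually.of_forall (hker x hx)),
      integral_add ((integrable_const _).indicator (measurableSet_singleton 1))
        ((hki x hx).const_mul _), integral_indicator_const _ (measurableSet_singleton 1)]
    rfl

/-! ### From harmonic means to positive real functions -/

/-- The open right half-plane. -/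
def rightHalfPlane : Set ℂ := {w | 0 < w.re}

theorem isOpen_rightHalfPlane : IsOpen rightHalfPlane :=
  isOpen_lt continuous_const Complex.continuous_re

theorem ne_zero_of_re_pos {w : ℂ} (hw : 0 < w.re) : w ≠ 0 := by
  rintro rfl
  simp at hw

theorem re_inv_pos {w : ℂ} (hw : 0 < w.re) : 0 < (w⁻¹).re := by
  rw [Complex.inv_re]
  exact div_pos hw (Complex.normSq_pos.2 (ne_zero_of_re_pos hw))

theorem re_admittance_denom_pos {w : ℂ} (hw : 0 < w.re) (s : I) :
    0 < ((1 - (s : ℂ)) * w + s * w⁻¹).re := by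
  have h1 : ((1 - (s : ℂ)) * w + s * w⁻¹).re = (1 - s) * w.re + s * (w⁻¹).re := by
    rw [← Complex.ofReal_one, ← Complex.ofReal_sub, Complex.add_re, Complex.re_ofReal_mul,
      Complex.re_ofReal_mul]
  rw [h1]
  have h2 := re_inv_pos hw
  have h3 := mul_nonneg (sub_nonneg.2 s.2.2) hw.le
  rcases eq_or_lt_of_le s.2.1 with h | h
  · simpa [← h] using hw
  · have := mul_pos h h2
    linarith

theorem differentiableOn_integral_admittance (μ : Measure I) [IsFiniteMeasure μ] :
    DifferentiableOn ℂ (fun w : ℂ => ∫ s : I, ((1 - (s : ℂ)) * w + s * w⁻¹)⁻¹ ∂μ)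
      rightHalfPlane := by
  intro w₀ hw₀
  have hD : ∀ w ∈ rightHalfPlane, ∀ s : I, (1 - (s : ℂ)) * w + s * w⁻¹ ≠ 0 := fun w hw s =>
    ne_zero_of_re_pos (re_admittance_denom_pos hw s)
  let F' : ℂ → I → ℂ := fun w s =>
    -((1 - (s : ℂ)) * 1 + s * (-(w ^ 2)⁻¹)) / ((1 - (s : ℂ)) * w + s * w⁻¹) ^ 2
  have hF'c : ContinuousOn (fun z : ℂ × I => F' z.1 z.2) (rightHalfPlane ×ˢ univ) := by
    have h1 : ∀ z ∈ rightHalfPlane ×ˢ (univ : Set I), z.1 ≠ 0 := fun z hz =>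
      ne_zero_of_re_pos hz.1
    refine ContinuousOn.div ?_ ?_ fun z hz => pow_ne_zero 2 (hD z.1 hz.1 z.2)
    · refine ContinuousOn.neg (ContinuousOn.add (by fun_prop) (ContinuousOn.mul (by fun_prop) ?_))
      exact ((ContinuousOn.pow (by fun_prop) 2).inv₀ fun z hz => pow_ne_zero 2 (h1 z hz)).neg
    · refine ContinuousOn.pow (ContinuousOn.add (by fun_prop) (ContinuousOn.mul (by fun_prop) ?_)) 2
      exact ContinuousOn.inv₀ (by fun_prop) h1
  obtain ⟨r, hr, hsub⟩ := Metric.nhds_basis_closedBall.mem_iff.1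
    (isOpen_rightHalfPlane.mem_nhds hw₀)
  obtain ⟨B, hB⟩ := ((isCompact_closedBall w₀ r).prod isCompact_univ).exists_bound_of_continuousOn
    (hF'c.mono (prod_mono_left hsub))
  have hsl : ∀ w ∈ rightHalfPlane, Continuous (F' w) := fun w hw =>
    continuousOn_univ.1 (hF'c.comp (g := fun z : ℂ × I => F' z.1 z.2) (f := fun s => (w, s))
      (by fun_prop) fun s _ => ⟨hw, mem_univ _⟩)
  have hFc : ∀ w ∈ rightHalfPlane, Continuous fun s : I => ((1 - (s : ℂ)) * w + s * w⁻¹)⁻¹ :=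
    fun w hw => Continuous.inv₀ (by fun_prop) (hD w hw)
  refine (hasDerivAt_integral_of_dominated_loc_of_deriv_le (bound := fun _ => B) (F' := F')
    (Metric.closedBall_mem_nhds w₀ hr) ?_ ?_ ?_ ?_ (integrable_const B)
    ?_).2.differentiableAt.differentiableWithinAt
  · filter_upwards [isOpen_rightHalfPlane.mem_nhds hw₀] with w hw
      using (hFc w hw).aestronglyMeasurable
  · exact (hFc w₀ hw₀).integrable_of_hasCompactSupport (HasCompactSupport.of_compactSpace _)
  · exact (hsl w₀ hw₀).aestronglyMeasurable
  · exact Eventually.of_forall fun s w hw => hB (w, s) ⟨hw, mem_univ _⟩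
  · refine Eventually.of_forall fun s w hw => ?_
    have hw' := hsub hw
    have h2 : HasDerivAt (fun w : ℂ => (1 - (s : ℂ)) * w + s * w⁻¹)
        ((1 - (s : ℂ)) * 1 + s * (-(w ^ 2)⁻¹)) w :=
      ((hasDerivAt_id w).const_mul _).add ((hasDerivAt_inv (ne_zero_of_re_pos hw')).const_mul _)
    exact h2.inv (hD w hw' s)

/-- At `x = w²` the kernel is `w ((1-s) w + s/w)⁻¹`, and the half-plane is stable under inversion
and convex combination. The measure is nonzero, so the real part of the integral is strictly
positive. -/
theorem exists_positiveReal_of_mem_harmonicMeans {f : PosReal → ℝ} (hf : f ∈ harmonicMeans)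
    (hf0 : f ≠ 0) : ∃ Φ : ℂ → ℂ, DifferentiableOn ℂ Φ rightHalfPlane ∧
      (∀ w ∈ rightHalfPlane, 0 < (Φ w).re) ∧
      ∀ x : PosReal, (f x : ℂ) = Real.sqrt x * Φ (Real.sqrt x) := by
  obtain ⟨μ, hμ, hf⟩ := hf
  have hμ0 : μ ≠ 0 := by
    rintro rfl
    exact hf0 (funext fun x => by simp [hf])
  have hFi : ∀ w ∈ rightHalfPlane, Integrable (fun s : I => ((1 - (s : ℂ)) * w + s * w⁻¹)⁻¹) μ :=
    fun w hw => (Continuous.inv₀ (by fun_prop) fun s =>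
      ne_zero_of_re_pos (re_admittance_denom_pos hw s)).integrable_of_hasCompactSupport
        (HasCompactSupport.of_compactSpace _)
  refine ⟨_, differentiableOn_integral_admittance μ, fun w hw => ?_, fun x => ?_⟩
  · have hpos : ∀ s : I, 0 < (((1 - (s : ℂ)) * w + s * w⁻¹)⁻¹).re := fun s =>
      re_inv_pos (re_admittance_denom_pos hw s)
    have h1 := integral_re (hFi w hw)
    simp only [RCLike.re_to_complex] at h1
    rw [← h1, integral_pos_iff_support_of_nonneg (fun s => (hpos s).le) (hFi w hw).re,
      show (Function.support fun s : I => (((1 - (s : ℂ)) * w + s * w⁻¹)⁻¹).re) = univ from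
        eq_univ_of_forall fun s => (hpos s).ne']
    exact Measure.measure_univ_pos.2 hμ0
  · rw [hf, ← integral_complex_ofReal, ← integral_const_mul]
    refine integral_congr_ae (Eventually.of_forall fun s => ?_)
    have hx : (0 : ℝ) < x := x.2
    have hw : 0 < Real.sqrt x := Real.sqrt_pos.2 hx
    have e : harmonicKernel x s =
        Real.sqrt x * ((1 - s) * Real.sqrt x + s * (Real.sqrt x)⁻¹)⁻¹ := by
      have h1 := harmonicKernel_denom_pos hx s
      have h2 : (1 - (s : ℝ)) * Real.sqrt x + s * (Real.sqrt x)⁻¹ =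
          ((1 - s) * x + s) * (Real.sqrt x)⁻¹ := by
        nth_rewrite 3 [← Real.mul_self_sqrt hx.le]
        field_simp
      rw [h2, mul_inv, inv_inv, harmonicKernel]
      nth_rewrite 1 [← Real.mul_self_sqrt hx.le]
      field_simp
    simp only [e]
    push_cast
    ring

/-! ### From positive real functions to harmonic means: the Poisson formula -/

theorem mem_rightHalfPlane_cayley {ζ : ℂ} (hζ : ‖ζ‖ < 1) : (1 + ζ) / (1 - ζ) ∈ rightHalfPlane := by
  have h1 : 1 - ζ ≠ 0 := by
    intro h
    rw [← sub_eq_zero.1 h] at hζ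
    simp at hζ
  have h2 : Complex.normSq ζ < 1 := by
    rw [Complex.normSq_eq_norm_sq]
    nlinarith [norm_nonneg ζ]
  rw [Complex.normSq_apply] at h2
  change 0 < ((1 + ζ) / (1 - ζ)).re
  rw [Complex.div_re, ← add_div]
  refine div_pos ?_ (Complex.normSq_pos.2 h1)
  simp
  nlinarith

/-- The Cayley transform carries `(√x - 1)/(√x + 1)` to `√x`. At such a real point the Poisson
kernel depends on `θ` only through `cos θ`. -/
theorem sqrt_mul_poissonKernel {x : ℝ} (hx : 0 < x) (θ : ℝ) {s : I}
    (hs : (s : ℝ) = (1 + Real.cos θ) / 2) :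
    Real.sqrt x * poissonKernel 0 (((Real.sqrt x - 1) / (Real.sqrt x + 1) : ℝ) : ℂ)
      (circleMap 0 1 θ) = harmonicKernel x s := by
  have hw : 0 < Real.sqrt x := Real.sqrt_pos.2 hx
  have hxw : x = Real.sqrt x ^ 2 := (Real.sq_sqrt hx.le).symm
  have h1 := harmonicKernel_denom_pos hx s
  rw [harmonicKernel]
  set w := Real.sqrt x
  rw [hxw] at h1 ⊢
  set y : ℝ := (w - 1) / (w + 1)
  have hn : ‖circleMap 0 1 θ - (y : ℂ)‖ ^ 2 = 1 - 2 * y * Real.cos θ + y ^ 2 := by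
    rw [← Complex.normSq_eq_norm_sq, Complex.normSq_apply]
    simp only [circleMap, zero_add, Complex.ofReal_one, one_mul, Complex.sub_re, Complex.sub_im,
      Complex.exp_ofReal_mul_I_re, Complex.exp_ofReal_mul_I_im, Complex.ofReal_re,
      Complex.ofReal_im]
    nlinarith [Real.sin_sq_add_cos_sq θ]
  rw [poissonKernel]
  simp only [sub_zero, hn]
  rw [norm_circleMap_zero, Complex.norm_real, Real.norm_eq_abs, sq_abs, sq_abs, one_pow]
  have hc : Real.cos θ = 2 * s - 1 := by rw [hs]; ring
  have hwp : w + 1 ≠ 0 := by positivity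
  have e1 : 1 - y ^ 2 = 4 * w / (w + 1) ^ 2 := by
    simp only [y]; field_simp; ring
  have e2 : 1 - 2 * y * Real.cos θ + y ^ 2 = 4 * ((1 - s) * w ^ 2 + s) / (w + 1) ^ 2 := by
    rw [hc]; simp only [y]; field_simp; ring
  rw [e1, e2]
  field_simp

/-- Transport `Φ` to the disc and dilate by `r < 1`, so that it is analytic up to the circle. The
Poisson formula then has the nonnegative boundary values of the real part as weight; let `r` tend to
`1`. -/
theorem mem_harmonicMeans_of_positiveReal {f : PosReal → ℝ} {Φ : ℂ → ℂ}
    (hΦ : DifferentiableOn ℂ Φ rightHalfPlane) (hre : ∀ w ∈ rightHalfPlane, 0 ≤ (Φ w).re)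
    (hf : ∀ x : PosReal, (f x : ℂ) = Real.sqrt x * Φ (Real.sqrt x)) : f ∈ harmonicMeans := by
  let r : ℕ → ℝ := fun n => n / (n + 1)
  have hr0 : ∀ n, 0 ≤ r n := fun n => by positivity
  have hr1 : ∀ n, r n < 1 := fun n => (div_lt_one (by positivity)).2 (by linarith)
  have hrlim : Tendsto r atTop (𝓝 1) := tendsto_natCast_div_add_atTop (1 : ℝ)
  let F : ℕ → ℂ → ℂ := fun n ζ => Φ ((1 + r n * ζ) / (1 - r n * ζ))
  have hrn : ∀ n (ζ : ℂ), ‖ζ‖ ≤ 1 → ‖(r n : ℂ) * ζ‖ < 1 := fun n ζ hζ => by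
    rw [norm_mul, Complex.norm_real, Real.norm_of_nonneg (hr0 n)]
    nlinarith [hr0 n, hr1 n, norm_nonneg ζ]
  have hne : ∀ ζ : ℂ, ‖ζ‖ < 1 → 1 - ζ ≠ 0 := fun ζ hζ h => by
    rw [← sub_eq_zero.1 h] at hζ
    simp at hζ
  have hFa : ∀ n (ζ : ℂ), ‖ζ‖ ≤ 1 → AnalyticAt ℂ (F n) ζ := fun n ζ hζ => by
    have h1 : AnalyticAt ℂ Φ ((1 + r n * ζ) / (1 - r n * ζ)) :=
      hΦ.analyticAt (isOpen_rightHalfPlane.mem_nhds (mem_rightHalfPlane_cayley (hrn n ζ hζ)))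
    refine AnalyticAt.fun_comp h1 ?_
    exact AnalyticAt.div (by fun_prop) (by fun_prop) (hne _ (hrn n ζ hζ))
  let S : ℝ → I := fun θ => ⟨(1 + Real.cos θ) / 2,
    by linarith [Real.neg_one_le_cos θ], by linarith [Real.cos_le_one θ]⟩
  have hS : Measurable S := by
    refine Measurable.subtype_mk ?_
    fun_prop
  let y : ℝ → ℝ := fun x => (Real.sqrt x - 1) / (Real.sqrt x + 1)
  have hy : ∀ x : ℝ, 0 < x → ‖(y x : ℂ)‖ < 1 := fun x hx => by
    have hw : 0 < Real.sqrt x := Real.sqrt_pos.2 hx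
    rw [Complex.norm_real, Real.norm_eq_abs, abs_lt]
    constructor
    · rw [lt_div_iff₀ (by positivity)]; linarith
    · rw [div_lt_one (by positivity)]; linarith
  have hcircle : ∀ n, Continuous fun θ : ℝ => (F n (circleMap 0 1 θ)).re := fun n => by
    refine Complex.continuous_re.comp (continuous_iff_continuousAt.2 fun θ => ?_)
    exact ContinuousAt.comp (g := F n) (f := circleMap 0 1)
      (hFa n _ (by simp)).continuousAt (continuous_circleMap 0 1).continuousAt
  refine mem_harmonicMeans_of_tendsto
    (F := fun n x => Real.sqrt x * (F n (y x)).re) (fun n => ?_) fun x => ?_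
  · refine mem_harmonicMeans_of_integral (m := volume.restrict (Ioc 0 (2 * Real.pi))) hS
      (W := fun θ => (2 * Real.pi)⁻¹ * (F n (circleMap 0 1 θ)).re) ?_ ?_ fun x => ?_
    · exact ((hcircle n).const_mul _).integrableOn_Ioc
    · refine fun θ => mul_nonneg (by positivity) (hre _ (mem_rightHalfPlane_cayley (hrn n _ ?_)))
      simp
    · have hx : (0 : ℝ) < x := x.2
      have hharm : InnerProductSpace.HarmonicOnNhd (fun ζ => (F n ζ).re) (Metric.closedBall 0 1) :=
        fun ζ hζ => (hFa n ζ (by simpa using hζ)).harmonicAt_re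
      have hP := hharm.circleAverage_poissonKernel_smul (w := (y x : ℂ))
        (by simpa using hy x hx)
      rw [← hP, Real.circleAverage_def, smul_eq_mul,
        intervalIntegral.integral_of_le (by positivity), ← mul_assoc, ← integral_const_mul]
      refine integral_congr_ae (Eventually.of_forall fun θ => ?_)
      have hk := sqrt_mul_poissonKernel hx θ (s := S θ) rfl
      simp only [Pi.smul_apply', smul_eq_mul]
      rw [← hk]
      ring
  · have hx : (0 : ℝ) < x := x.2
    have hw : 0 < Real.sqrt x := Real.sqrt_pos.2 hx
    have hfx : f x = Real.sqrt x * (Φ (Real.sqrt x)).re := by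
      have := congrArg Complex.re (hf x)
      rwa [Complex.ofReal_re, Complex.re_ofReal_mul] at this
    rw [hfx]
    refine Tendsto.const_mul _ ((Complex.continuous_re.tendsto _).comp ?_)
    have hc : ContinuousAt Φ (Real.sqrt x : ℂ) :=
      (hΦ.differentiableAt (isOpen_rightHalfPlane.mem_nhds
        (by simpa [rightHalfPlane] using hx))).continuousAt
    refine hc.tendsto.comp ?_
    have hlim : Tendsto (fun n => (1 + (r n : ℂ) * y x) / (1 - (r n : ℂ) * y x)) atTop
        (𝓝 ((1 + ((1 : ℝ) : ℂ) * y x) / (1 - ((1 : ℝ) : ℂ) * y x))) := by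
      have h1 : Tendsto (fun n => (r n : ℂ) * y x) atTop (𝓝 (((1 : ℝ) : ℂ) * y x)) :=
        ((Complex.continuous_ofReal.tendsto _).comp hrlim).mul_const _
      refine (h1.const_add 1).div (h1.const_sub 1) ?_
      rw [Complex.ofReal_one, one_mul]
      exact hne _ (hy x hx)
    have e : (1 + ((1 : ℝ) : ℂ) * y x) / (1 - ((1 : ℝ) : ℂ) * y x) = Real.sqrt x := by
      rw [Complex.ofReal_one, one_mul]
      norm_cast
      simp only [y]
      have : Real.sqrt x + 1 ≠ 0 := by positivity
      field_simp
      ring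
    rwa [e] at hlim

/-! ### Arguments and Phragmén–Lindelöf -/

theorem differentiableOn_log_of_re_pos {U : Set ℂ} {Φ : ℂ → ℂ} (hΦ : DifferentiableOn ℂ Φ U)
    (hre : ∀ w ∈ U, 0 < (Φ w).re) : DifferentiableOn ℂ (fun w => Complex.log (Φ w)) U :=
  fun w hw => (hΦ w hw).clog (Complex.mem_slitPlane_iff.2 (Or.inl (hre w hw)))

theorem abs_arg_lt_of_re_pos {z : ℂ} (hz : 0 < z.re) : |z.arg| < Real.pi / 2 :=
  Complex.abs_arg_lt_pi_div_two_iff.2 (Or.inl hz)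

/-- Write the sum both as `arg w + 2 arg z` and as `2 arg (w z) - arg w`, with `arg z` and `arg (w
z)` below `π/2` in modulus. -/
theorem abs_arg_add_two_mul_arg_le {w z : ℂ} (hw : 0 < w.re) (hz : 0 < z.re)
    (hwz : 0 < (w * z).re) : |w.arg + 2 * z.arg| ≤ Real.pi - |w.arg| := by
  have h1 := abs_lt.1 (abs_arg_lt_of_re_pos hw)
  have h2 := abs_lt.1 (abs_arg_lt_of_re_pos hz)
  have h3 := abs_lt.1 (abs_arg_lt_of_re_pos hwz)
  rw [Complex.arg_mul (ne_zero_of_re_pos hw) (ne_zero_of_re_pos hz)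
    ⟨by linarith, by linarith⟩] at h3
  rw [abs_le]
  rcases abs_cases w.arg with ⟨h, -⟩ | ⟨h, -⟩ <;> rw [h] <;> constructor <;> linarith

theorem exp_mem_rightHalfPlane {v : ℂ} (hv : |v.im| < Real.pi / 2) :
    Complex.exp v ∈ rightHalfPlane := by
  change 0 < (Complex.exp v).re
  rw [Complex.exp_re]
  exact mul_pos (Real.exp_pos _) (Real.cos_pos_of_mem_Ioo (abs_lt.1 hv))

/-- Phragmén–Lindelöf: on the right half-plane, `arg w + 2 arg Φ(w)` is controlled by its boundary
values. -/
theorem abs_arg_add_two_mul_arg_le_pi_div_two {Φ : ℂ → ℂ} (hΦ : DifferentiableOn ℂ Φ rightHalfPlane)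
    (hre : ∀ w ∈ rightHalfPlane, 0 < (Φ w).re) (hre' : ∀ w ∈ rightHalfPlane, 0 < (w * Φ w).re)
    {w : ℂ} (hw : w ∈ rightHalfPlane) : |w.arg + 2 * (Φ w).arg| ≤ Real.pi / 2 := by
  have harg : ∀ v : ℂ, |v.im| < Real.pi / 2 → (Complex.exp v).arg = v.im := fun v hv => by
    have h := abs_lt.1 hv
    rw [← Complex.log_im, Complex.log_exp] <;> linarith [Real.pi_pos]
  -- The variable `v = log w` turns the half-plane into the strip `|Im v| < π/2`, and `Im L` is the
  -- sum of arguments to be bounded.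
  let L : ℂ → ℂ := fun v => v + 2 * Complex.log (Φ (Complex.exp v))
  have hL : ∀ v : ℂ, |v.im| < Real.pi / 2 → |(L v).im| ≤ Real.pi - |v.im| := fun v hv => by
    have hm := exp_mem_rightHalfPlane hv
    have h := abs_arg_add_two_mul_arg_le hm (hre _ hm) (hre' _ hm)
    rw [harg v hv] at h
    simpa [L, Complex.log_im] using h
  have hLd : ∀ v : ℂ, |v.im| < Real.pi / 2 → DifferentiableAt ℂ L v := fun v hv => by
    have hm := exp_mem_rightHalfPlane hv
    have h1 : DifferentiableAt ℂ (fun w => Complex.log (Φ w)) (Complex.exp v) :=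
      (differentiableOn_log_of_re_pos hΦ hre).differentiableAt (isOpen_rightHalfPlane.mem_nhds hm)
    have h2 : DifferentiableAt ℂ (fun v => Complex.log (Φ (Complex.exp v))) v :=
      h1.comp v Complex.differentiable_exp.differentiableAt
    exact differentiableAt_id.add (h2.const_mul 2)
  have main : ∀ τ : ℝ, |τ| = 1 → ∀ v : ℂ, |v.im| < Real.pi / 2 → τ * (L v).im ≤ Real.pi / 2 := by
    intro τ hτ v hv
    -- Boundary values on the full strip need not exist; a narrower strip avoids them, and `θ` then
    -- tends to `π/2`.
    have key : ∀ θ, |v.im| < θ → θ < Real.pi / 2 → τ * (L v).im ≤ Real.pi - θ := by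
      intro θ h1 h2
      have hθ : 0 < θ := (abs_nonneg _).trans_lt h1
      let F : ℂ → ℂ := fun v => Complex.exp (-(τ : ℂ) * Complex.I * L v)
      have hF : ∀ v, ‖F v‖ = Real.exp (τ * (L v).im) := fun v => by
        simp only [F, Complex.norm_exp]
        congr 1
        simp
      have hb : ∀ v : ℂ, |v.im| ≤ θ → ‖F v‖ ≤ Real.exp (Real.pi - |v.im|) := fun v hv => by
        rw [hF, Real.exp_le_exp]
        refine (le_abs_self _).trans ?_
        rw [abs_mul, hτ, one_mul]
        exact hL v (hv.trans_lt h2)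
      have hcl : closure (Complex.im ⁻¹' Ioo (-θ) θ) ⊆ {v : ℂ | |v.im| ≤ θ} := by
        refine closure_minimal (fun v hv => (abs_lt.2 hv).le) ?_
        exact isClosed_le (by fun_prop) continuous_const
      have hd : DiffContOnCl ℂ F (Complex.im ⁻¹' Ioo (-θ) θ) := by
        refine DifferentiableOn.diffContOnCl fun v hv => ?_
        have h3 : |v.im| ≤ θ := hcl hv
        exact ((hLd v (h3.trans_lt h2)).const_mul _).cexp.differentiableWithinAt
      -- The pointwise bound makes `F` bounded by `exp π`, hence growth exponent `0` and constant
      -- `π`.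
      have := PhragmenLindelof.horizontal_strip (C := Real.exp (Real.pi - θ)) (z := v) hd
        ⟨0, div_pos Real.pi_pos (by linarith), Real.pi, ?_⟩ ?_ ?_ (abs_le.1 h1.le).1
        (abs_le.1 h1.le).2
      · rwa [hF, Real.exp_le_exp] at this
      · refine Asymptotics.IsBigO.of_bound 1 ?_
        filter_upwards [mem_inf_of_right (mem_principal_self _)] with z hz
        refine (hb z (abs_lt.2 hz).le).trans ?_
        rw [one_mul, zero_mul, Real.exp_zero, mul_one, Real.norm_of_nonneg (Real.exp_nonneg _),
          Real.exp_le_exp]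
        linarith [abs_nonneg z.im]
      · intro z hz
        have h3 : |z.im| = θ := by rw [hz, abs_neg, abs_of_pos hθ]
        simpa [h3] using hb z h3.le
      · intro z hz
        have h3 : |z.im| = θ := by rw [hz, abs_of_pos hθ]
        simpa [h3] using hb z h3.le
    by_contra! h
    obtain ⟨θ, h1, h2⟩ := exists_between (max_lt hv (show Real.pi - τ * (L v).im < Real.pi / 2 by
      linarith))
    have := key θ ((le_max_left _ _).trans_lt h1) h2
    have := (le_max_right _ _).trans_lt h1
    linarith
  have hlog : |(Complex.log w).im| < Real.pi / 2 := by
    rw [Complex.log_im]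
    exact abs_arg_lt_of_re_pos hw
  have hLw : (L (Complex.log w)).im = w.arg + 2 * (Φ w).arg := by
    simp [L, Complex.exp_log (ne_zero_of_re_pos hw), Complex.log_im]
  have h1 := main 1 (by simp) _ hlog
  have h2 := main (-1) (by simp) _ hlog
  rw [hLw] at h1 h2
  rw [abs_le]
  constructor <;> linarith

theorem re_mul_sq_nonneg {Φ : ℂ → ℂ} (hΦ : DifferentiableOn ℂ Φ rightHalfPlane)
    (hre : ∀ w ∈ rightHalfPlane, 0 < (Φ w).re) (hre' : ∀ w ∈ rightHalfPlane, 0 < (w * Φ w).re)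
    {w : ℂ} (hw : w ∈ rightHalfPlane) : 0 ≤ (w * Φ w ^ 2).re := by
  have h := abs_le.1 (abs_arg_add_two_mul_arg_le_pi_div_two hΦ hre hre' hw)
  have e : w * Φ w ^ 2 = Complex.exp (Complex.log w + 2 * Complex.log (Φ w)) := by
    rw [Complex.exp_add, Complex.exp_log (ne_zero_of_re_pos hw), two_mul,
      Complex.exp_add, Complex.exp_log (ne_zero_of_re_pos (hre w hw)), sq]
  rw [e, Complex.exp_re]
  refine mul_nonneg (Real.exp_nonneg _) (Real.cos_nonneg_of_mem_Icc ?_)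
  simpa [Complex.log_im] using h

/-! ### Geometric means and the dictionary for complete Bernstein functions -/

/-- The geometric mean of two complex numbers of the right half-plane. -/
def geometricMean (a b : ℂ) : ℂ := Complex.exp ((Complex.log a + Complex.log b) / 2)

theorem re_geometricMean_pos {a b : ℂ} (ha : 0 < a.re) (hb : 0 < b.re) :
    0 < (geometricMean a b).re := by
  have h1 := abs_lt.1 (abs_arg_lt_of_re_pos ha)
  have h2 := abs_lt.1 (abs_arg_lt_of_re_pos hb)
  rw [geometricMean, Complex.exp_re]
  refine mul_pos (Real.exp_pos _) (Real.cos_pos_of_mem_Ioo ?_)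
  have e : ((Complex.log a + Complex.log b) / 2).im = (a.arg + b.arg) / 2 := by
    rw [Complex.div_ofNat_im, Complex.add_im, Complex.log_im, Complex.log_im]
  rw [e]
  constructor <;> linarith

theorem geometricMean_ofReal {a b : ℝ} (ha : 0 < a) (hb : 0 < b) :
    geometricMean a b = (Real.sqrt (a * b) : ℝ) := by
  rw [geometricMean, ← Complex.ofReal_log ha.le, ← Complex.ofReal_log hb.le]
  rw [Real.sqrt_eq_rpow, Real.rpow_def_of_pos (mul_pos ha hb), Real.log_mul ha.ne' hb.ne']
  push_cast
  congr 1
  ring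

theorem differentiableOn_geometricMean {U : Set ℂ} {a b : ℂ → ℂ} (ha : DifferentiableOn ℂ a U)
    (hb : DifferentiableOn ℂ b U) (ha' : ∀ w ∈ U, 0 < (a w).re) (hb' : ∀ w ∈ U, 0 < (b w).re) :
    DifferentiableOn ℂ (fun w => geometricMean (a w) (b w)) U :=
  (((differentiableOn_log_of_re_pos ha ha').add (differentiableOn_log_of_re_pos hb hb')).div_const
    2).cexp

theorem exists_positiveReal_of_mem_CBF {f : PosReal → ℝ} (hf : f ∈ CBF) (hf0 : f ≠ 0) :
    ∃ Φ : ℂ → ℂ, DifferentiableOn ℂ Φ rightHalfPlane ∧ (∀ w ∈ rightHalfPlane, 0 < (Φ w).re) ∧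
      ∀ x : PosReal, (f x : ℂ) = Real.sqrt x * Φ (Real.sqrt x) :=
  exists_positiveReal_of_mem_harmonicMeans (CBF_subset_harmonicMeans hf) hf0

theorem mem_CBF_of_positiveReal {f : PosReal → ℝ} {Φ : ℂ → ℂ}
    (hΦ : DifferentiableOn ℂ Φ rightHalfPlane) (hre : ∀ w ∈ rightHalfPlane, 0 ≤ (Φ w).re)
    (hf : ∀ x : PosReal, (f x : ℂ) = Real.sqrt x * Φ (Real.sqrt x)) : f ∈ CBF :=
  harmonicMeans_subset_CBF (mem_harmonicMeans_of_positiveReal hΦ hre hf)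

theorem sqrt_mem_rightHalfPlane (x : PosReal) : (Real.sqrt x : ℂ) ∈ rightHalfPlane := by
  have hx : (0 : ℝ) < x := x.2
  simpa [rightHalfPlane] using hx

theorem pos_of_mem_CBF {f : PosReal → ℝ} (hf : f ∈ CBF) (hf0 : f ≠ 0) (x : PosReal) : 0 < f x := by
  obtain ⟨Φ, -, hre, hΦf⟩ := exists_positiveReal_of_mem_CBF hf hf0
  have h := congrArg Complex.re (hΦf x)
  rw [Complex.ofReal_re, Complex.re_ofReal_mul] at h
  rw [h]
  exact mul_pos (Real.sqrt_pos.2 x.2) (hre _ (sqrt_mem_rightHalfPlane x))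

theorem ne_zero_of_forall_pos {f : PosReal → ℝ} (hf : ∀ x, 0 < f x) : f ≠ 0 := fun h =>
  (hf ⟨1, by simp⟩).ne' (congrFun h _)

theorem positiveReal_sqrt {f : PosReal → ℝ} {Φ : ℂ → ℂ}
    (hf : ∀ x : PosReal, (f x : ℂ) = Real.sqrt x * Φ (Real.sqrt x)) (x : PosReal) :
    Φ (Real.sqrt x) = ((f x / Real.sqrt x : ℝ) : ℂ) := by
  have h : (Real.sqrt x : ℂ) ≠ 0 := ne_zero_of_re_pos (sqrt_mem_rightHalfPlane x)
  push_cast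
  rw [hf, mul_div_cancel_left₀ _ h]

/-- Identity theorem: the two functions agree at the points `1 + 1/(n+1)`, which accumulate at `1`.
-/
theorem eqOn_rightHalfPlane_of_eq_sqrt {f g : ℂ → ℂ} (hf : DifferentiableOn ℂ f rightHalfPlane)
    (hg : DifferentiableOn ℂ g rightHalfPlane)
    (h : ∀ x : PosReal, f (Real.sqrt x) = g (Real.sqrt x)) : EqOn f g rightHalfPlane := by
  refine (hf.analyticOnNhd isOpen_rightHalfPlane).eqOn_of_preconnected_of_mem_closure
    (hg.analyticOnNhd isOpen_rightHalfPlane) (convex_halfSpace_re_gt 0).isPreconnected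
    (z₀ := 1) (by simp [rightHalfPlane]) ?_
  have hlim : Tendsto (fun n : ℕ => ((1 + 1 / ((n : ℝ) + 1) : ℝ) : ℂ)) atTop (𝓝 1) := by
    have h1 := (tendsto_one_div_add_atTop_nhds_zero_nat (𝕜 := ℝ)).const_add 1
    rw [add_zero] at h1
    have h2 := (Complex.continuous_ofReal.tendsto _).comp h1
    rw [Complex.ofReal_one] at h2
    exact h2
  refine mem_closure_of_tendsto hlim (Eventually.of_forall fun n => ?_)
  have hn : (0 : ℝ) < 1 / ((n : ℝ) + 1) := Nat.one_div_pos_of_nat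
  refine ⟨?_, ?_⟩
  · have := h ⟨(1 + 1 / ((n : ℝ) + 1)) ^ 2, pow_pos (show 0 < 1 + 1 / ((n : ℝ) + 1) by linarith) 2⟩
    simpa only [mem_ofPred_eq, Real.sqrt_sq (show 0 ≤ 1 + 1 / ((n : ℝ) + 1) by linarith)] using this
  · rw [mem_singleton_iff]
    intro h1
    have h2 : (1 + 1 / ((n : ℝ) + 1)) = 1 := by exact_mod_cast h1
    linarith

/-! ### Wave numbers -/

theorem waveNumber_pos {ρ : ℝ} (hρ : 0 < ρ) {Q : PosReal → ℝ} (hQ : ∀ p, 0 < Q p) (p : PosReal) :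
    0 < waveNumber ρ Q p :=
  div_pos (mul_pos (Real.sqrt_pos.2 hρ) p.2) (Real.sqrt_pos.2 (hQ p))

/-- If `Q` corresponds to `Φ`, the geometric means of `1/Φ` with `w` and with `1/w` represent `κ`
and `κ/√p`, up to the factor `√ρ`. -/
theorem waveNumber_mem_of_mem_CBF {ρ : ℝ} {Q : PosReal → ℝ} (hQ : ∀ p, 0 < Q p)
    (hQC : Q ∈ CBF) : waveNumber ρ Q ∈ waveNumberClass := by
  obtain ⟨Φ, hΦ, hre, hf⟩ := exists_positiveReal_of_mem_CBF hQC (ne_zero_of_forall_pos hQ)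
  have hΦ0 : ∀ w ∈ rightHalfPlane, Φ w ≠ 0 := fun w hw => ne_zero_of_re_pos (hre w hw)
  have hinv : DifferentiableOn ℂ (fun w => (Φ w)⁻¹) rightHalfPlane := hΦ.inv hΦ0
  have hinv_re : ∀ w ∈ rightHalfPlane, 0 < ((Φ w)⁻¹).re := fun w hw => re_inv_pos (hre w hw)
  have hre_mul : ∀ z : ℂ, 0 < z.re → 0 ≤ ((Real.sqrt ρ : ℂ) * z).re := fun z hz => by
    rw [Complex.re_ofReal_mul]
    exact mul_nonneg (Real.sqrt_nonneg _) hz.le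
  have hΦx := positiveReal_sqrt hf
  refine ⟨?_, fun p => Real.sqrt ρ * Real.sqrt p / Real.sqrt (Q p), ?_, fun p => ?_⟩
  · refine mem_CBF_of_positiveReal (Φ := fun w => Real.sqrt ρ * geometricMean w (Φ w)⁻¹)
      ((differentiableOn_geometricMean differentiableOn_id hinv (fun w hw => hw)
        hinv_re).const_mul _) (fun w hw => hre_mul _ (re_geometricMean_pos hw (hinv_re w hw)))
      fun x => ?_
    have hx : (0 : ℝ) < x := x.2
    have hw := Real.sqrt_pos.2 hx
    have hq := Real.sqrt_pos.2 (hQ x)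
    simp only [hΦx]
    rw [← Complex.ofReal_inv, geometricMean_ofReal hw (inv_pos.2 (div_pos (hQ x) hw))]
    norm_cast
    rw [show Real.sqrt x * (Q x / Real.sqrt x)⁻¹ = x / Q x by
      rw [inv_div, ← mul_div_assoc, Real.mul_self_sqrt hx.le], Real.sqrt_div hx.le]
    simp only [waveNumber]
    nth_rewrite 1 [← Real.mul_self_sqrt hx.le]
    ring
  · refine mem_CBF_of_positiveReal (Φ := fun w => Real.sqrt ρ * geometricMean w⁻¹ (Φ w)⁻¹)
      ((differentiableOn_geometricMean (differentiableOn_id.inv fun w hw => ne_zero_of_re_pos hw)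
        hinv (fun w hw => re_inv_pos hw) hinv_re).const_mul _)
      (fun w hw => hre_mul _ (re_geometricMean_pos (re_inv_pos hw) (hinv_re w hw))) fun x => ?_
    have hx : (0 : ℝ) < x := x.2
    have hw := Real.sqrt_pos.2 hx
    simp only [hΦx]
    rw [← Complex.ofReal_inv, ← Complex.ofReal_inv,
      geometricMean_ofReal (inv_pos.2 hw) (inv_pos.2 (div_pos (hQ x) hw))]
    norm_cast
    rw [show (Real.sqrt x)⁻¹ * (Q x / Real.sqrt x)⁻¹ = (Q x)⁻¹ by
      have := (hQ x).ne'
      field_simp, Real.sqrt_inv]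
    ring
  · have hx : (0 : ℝ) < p := p.2
    simp only [waveNumber]
    nth_rewrite 1 [← Real.mul_self_sqrt hx.le]
    ring

theorem mem_CBF_of_waveNumber_mem {ρ : ℝ} (hρ : 0 < ρ) {Q : PosReal → ℝ} (hQ : ∀ p, 0 < Q p)
    (hκ : waveNumber ρ Q ∈ waveNumberClass) : Q ∈ CBF := by
  obtain ⟨hκ, h, hh, hκh⟩ := hκ
  have hκpos := waveNumber_pos hρ hQ
  have hhpos : ∀ p, 0 < h p := fun p => by
    have := hκpos p
    rw [hκh] at this
    exact (pos_iff_pos_of_mul_pos this).1 (Real.sqrt_pos.2 p.2)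
  obtain ⟨Ψ, hΨ, hΨre, hΨf⟩ := exists_positiveReal_of_mem_CBF hκ (ne_zero_of_forall_pos hκpos)
  obtain ⟨Φ, hΦ, hre, hf⟩ := exists_positiveReal_of_mem_CBF hh (ne_zero_of_forall_pos hhpos)
  -- This extends `κ = √p h` off the real axis; it makes `wΦ` itself of positive real part.
  have heq : EqOn Ψ (fun w => w * Φ w) rightHalfPlane := by
    refine eqOn_rightHalfPlane_of_eq_sqrt hΨ (differentiableOn_id.fun_mul hΦ) fun x => ?_
    have hw := (Real.sqrt_pos.2 x.2).ne'
    rw [positiveReal_sqrt hΨf, positiveReal_sqrt hf, hκh]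
    norm_cast
    field_simp
  have hre' : ∀ w ∈ rightHalfPlane, 0 < (w * Φ w).re := fun w hw => by
    have h1 := hΨre w hw
    rwa [heq hw] at h1
  have hne : ∀ w ∈ rightHalfPlane, w * Φ w ^ 2 ≠ 0 := fun w hw =>
    mul_ne_zero (ne_zero_of_re_pos hw) (pow_ne_zero 2 (ne_zero_of_re_pos (hre w hw)))
  have hd : DifferentiableOn ℂ (fun w => w * Φ w ^ 2) rightHalfPlane :=
    differentiableOn_id.fun_mul (hΦ.fun_pow 2)
  have hd' : DifferentiableOn ℂ (fun w => (ρ : ℂ) * (w * Φ w ^ 2)⁻¹) rightHalfPlane :=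
    (hd.fun_inv hne).const_mul _
  refine mem_CBF_of_positiveReal hd' (fun w hw => ?_) fun x => ?_
  · rw [Complex.re_ofReal_mul, Complex.inv_re]
    exact mul_nonneg hρ.le (div_nonneg (re_mul_sq_nonneg hΦ hre hre' hw) (Complex.normSq_nonneg _))
  · have hx : (0 : ℝ) < x := x.2
    have hw := Real.sqrt_pos.2 hx
    have hq := Real.sqrt_pos.2 (hQ x)
    have hh' : h x = Real.sqrt ρ * Real.sqrt x / Real.sqrt (Q x) := by
      have h1 := hκh x
      simp only [waveNumber] at h1
      rw [← mul_right_inj' hw.ne', ← h1]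
      nth_rewrite 1 [← Real.mul_self_sqrt hx.le]
      ring
    have e : h x / Real.sqrt x = Real.sqrt ρ / Real.sqrt (Q x) := by
      rw [hh']
      field_simp
    have e2 : Q x = Real.sqrt x * (ρ * (Real.sqrt x * (h x / Real.sqrt x) ^ 2)⁻¹) := by
      have hQx := hQ x
      rw [e, div_pow, Real.sq_sqrt hρ.le, Real.sq_sqrt hQx.le]
      field_simp
    simp only [positiveReal_sqrt hf x]
    exact_mod_cast e2

theorem mem_CBF_iff_waveNumber_mem {ρ : ℝ} (hρ : 0 < ρ) {Q : PosReal → ℝ} (hQ : ∀ p, 0 < Q p) :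
    Q ∈ CBF ↔ waveNumber ρ Q ∈ waveNumberClass :=
  ⟨waveNumber_mem_of_mem_CBF hQ, mem_CBF_of_waveNumber_mem hρ hQ⟩

theorem bijOn_waveNumber {ρ : ℝ} (hρ : 0 < ρ) :
    BijOn (waveNumber ρ) (CBF \ {0}) (waveNumberClass \ {0}) := by
  have hr := Real.sqrt_pos.2 hρ
  refine ⟨?_, ?_, ?_⟩
  · rintro Q ⟨hQ, hQ0⟩
    have hpos := pos_of_mem_CBF hQ hQ0
    exact ⟨waveNumber_mem_of_mem_CBF hpos hQ, ne_zero_of_forall_pos (waveNumber_pos hρ hpos)⟩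
  · rintro Q ⟨hQ, hQ0⟩ R ⟨hR, hR0⟩ h
    funext p
    have hQp := pos_of_mem_CBF hQ hQ0 p
    have hRp := pos_of_mem_CBF hR hR0 p
    have h1 := congrFun h p
    simp only [waveNumber] at h1
    rw [div_eq_div_iff (Real.sqrt_pos.2 hQp).ne' (Real.sqrt_pos.2 hRp).ne',
      mul_right_inj' (mul_pos hr p.2).ne', Real.sqrt_inj hRp.le hQp.le] at h1
    exact h1.symm
  · rintro κ ⟨hκ, hκ0⟩
    have hpos := pos_of_mem_CBF hκ.1 hκ0
    have hQpos : ∀ p : PosReal, 0 < (Real.sqrt ρ * p / κ p) ^ 2 := fun p =>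
      pow_pos (div_pos (mul_pos hr p.2) (hpos p)) 2
    have hwave : waveNumber ρ (fun p => (Real.sqrt ρ * p / κ p) ^ 2) = κ := by
      funext p
      have hp : (0 : ℝ) < p := p.2
      have hk := hpos p
      simp only [waveNumber]
      rw [Real.sqrt_sq (div_pos (mul_pos hr hp) hk).le]
      field_simp
    -- The preimage solves `κ = √ρ p / √Q` for `Q`.
    refine ⟨fun p => (Real.sqrt ρ * p / κ p) ^ 2, ⟨?_, ne_zero_of_forall_pos hQpos⟩, hwave⟩
    exact mem_CBF_of_waveNumber_mem hρ hQpos (by rwa [hwave])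

theorem const_mul_div_mem_CBF {ρ : ℝ} (hρ : 0 ≤ ρ) {Q : PosReal → ℝ} (hQ : ∀ p, 0 < Q p)
    (hQC : Q ∈ CBF) : (fun p : PosReal => ρ * p / Q p) ∈ CBF := by
  obtain ⟨Φ, hΦ, hre, hf⟩ := exists_positiveReal_of_mem_CBF hQC (ne_zero_of_forall_pos hQ)
  refine mem_CBF_of_positiveReal (Φ := fun w => (ρ : ℂ) * (Φ w)⁻¹)
    ((hΦ.inv fun w hw => ne_zero_of_re_pos (hre w hw)).const_mul _) (fun w hw => ?_) fun x => ?_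
  · rw [Complex.re_ofReal_mul]
    exact mul_nonneg hρ (re_inv_pos (hre w hw)).le
  · have hx : (0 : ℝ) < x := x.2
    have hw := Real.sqrt_pos.2 hx
    have hq := hQ x
    simp only [positiveReal_sqrt hf x]
    norm_cast
    nth_rewrite 1 [← Real.mul_self_sqrt hx.le]
    field_simp

theorem waveNumber_sq_div {ρ : ℝ} (hρ : 0 < ρ) {Q : PosReal → ℝ} (hQ : ∀ p, 0 < Q p) (p : PosReal) :
    waveNumber ρ Q p ^ 2 / p = ρ * p / Q p := by
  have hp : (0 : ℝ) < p := p.2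
  rw [waveNumber, div_pow, mul_pow, Real.sq_sqrt hρ.le, Real.sq_sqrt (hQ p).le]
  field_simp

/-! ### Completely monotonic relaxation moduli -/

theorem IsLICM.laplaceConverges {G : ℝ → ℝ} (hG : IsLICM G) {p : ℝ} (hp : 0 < p) :
    LaplaceConverges G p := by
  refine hG.toIsCM.laplaceConverges ?_ hp
  exact (hG.locallyIntegrableOn.integrableOn_compact_subset Icc_subset_Ici_self
    isCompact_Icc).mono_set Ioc_subset_Icc_self

theorem IsLICM.modulusQ_mem_CBF {G : ℝ → ℝ} (hG : IsLICM G) : modulusQ G ∈ CBF :=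
  mem_CBF_iff.2 ⟨0, le_rfl, G, hG.toIsCM, fun _ hp => hG.laplaceConverges hp, fun x => by
    simp [modulusQ]⟩

/-- A decreasing function that is positive at `t` is positive on all of `]0, t[`. -/
theorem IsLICM.modulusQ_pos {G : ℝ → ℝ} (hG : IsLICM G) (hG0 : ∃ t : ℝ, 0 < t ∧ G t ≠ 0)
    (p : PosReal) : 0 < modulusQ G p := by
  obtain ⟨t, ht, hGt⟩ := hG0
  have hGt' : 0 < G t := lt_of_le_of_ne (hG.toIsCM.nonneg_apply ht) hGt.symm
  refine mul_pos p.2 ?_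
  rw [laplace, setIntegral_pos_iff_support_of_nonneg_ae ?_ (hG.laplaceConverges p.2)]
  · have hsub : Ioo 0 t ⊆ (Function.support fun t => G t * Real.exp (-(p * t))) ∩ Ioi 0 := by
      intro s hs
      refine ⟨(mul_pos (hGt'.trans_le ?_) (Real.exp_pos _)).ne', hs.1⟩
      exact hG.toIsCM.antitoneOn hs.1 ht hs.2.le
    refine lt_of_lt_of_le ?_ (measure_mono hsub)
    simpa using ht
  · filter_upwards [ae_restrict_mem measurableSet_Ioi] with s hs
    exact mul_nonneg (hG.toIsCM.nonneg_apply hs) (Real.exp_nonneg _)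

end Viscoelastic

end

theorem mainTheorem2 (ρ : ℝ) (hρ : 0 < ρ) :
    -- the equivalence, for the function `Q` of a relaxation modulus `G`
    (∀ G : ℝ → ℝ, (∀ p : ℝ, 0 < p → Viscoelastic.LaplaceConverges G p) →
      (∀ p : Viscoelastic.PosReal, 0 < Viscoelastic.modulusQ G p) →
      (Viscoelastic.modulusQ G ∈ Viscoelastic.CBF ↔
        Viscoelastic.waveNumber ρ (Viscoelastic.modulusQ G) ∈ Viscoelastic.waveNumberClass)) ∧
    -- the equivalence, for an arbitrary positive function `Q`
    (∀ Q : Viscoelastic.PosReal → ℝ, (∀ p, 0 < Q p) →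
      (Q ∈ Viscoelastic.CBF ↔ Viscoelastic.waveNumber ρ Q ∈ Viscoelastic.waveNumberClass)) ∧
    -- the bijection; the zero function, for which `κ` is not defined, is left out
    Set.BijOn (Viscoelastic.waveNumber ρ) (Viscoelastic.CBF \ {0})
      (Viscoelastic.waveNumberClass \ {0}) ∧
    -- the consequence for a completely monotonic relaxation modulus
    (∀ G : ℝ → ℝ, Viscoelastic.IsLICM G → (∃ t : ℝ, 0 < t ∧ G t ≠ 0) →
      (∀ p : ℝ, 0 < p → Viscoelastic.LaplaceConverges G p) ∧
      (∀ p : Viscoelastic.PosReal, 0 < Viscoelastic.modulusQ G p) ∧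
      (fun p : Viscoelastic.PosReal =>
        Viscoelastic.waveNumber ρ (Viscoelastic.modulusQ G) p ^ 2 / (p : ℝ)) ∈
          Viscoelastic.CBF) := by
  have key := fun (Q : Viscoelastic.PosReal → ℝ) (hQ : ∀ p, 0 < Q p) =>
    Viscoelastic.mem_CBF_iff_waveNumber_mem hρ hQ
  refine ⟨fun G _ hpos => key _ hpos, key, Viscoelastic.bijOn_waveNumber hρ, fun G hG hG0 => ?_⟩
  have hpos := hG.modulusQ_pos hG0
  refine ⟨fun p hp => hG.laplaceConverges hp, hpos, ?_⟩
  simp only [Viscoelastic.waveNumber_sq_div hρ hpos]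
  exact Viscoelastic.const_mul_div_mem_CBF hρ.le hpos hG.modulusQ_mem_CBF
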